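/- Let $N\ge 3$, $1<p<\infty$, $2^*=\frac{2N}{N-2}$, and let $(2^*)'$ be the conjugate exponent of $2^*$. For an open set $\Omega\subset\mathbb{R}^N$ (of finite or infinite measure), let $W^{1,2}_0(\Omega)$ be the homogeneous Sobolev space, i.e. the completion of $C^\infty_0(\Omega)$ with respect to $\|u\|_{W^{1,2}_0(\Omega)}=\left(\int_\Omega|\nabla u|^2\,dx\right)^{1/2}$ (a space of functions, contained in $L^{2^*}(\Omega)$), and let $W^{-1,2}(\Omega)$ be its dual. For $f\in W^{-1,2}(\Omega)$ and measurable $V:\Omega\to[0,+\infty]$ put $$\mathcal{E}_f(V)=\min_{u\in W^{1,2}_0(\Omega)}\left\{\frac12\int_\Omega|\nabla u|^2\,dx+\frac12\int_\Omega V u^2\,dx-\langle f,u\rangle\right\}$$ (with $\infty\cdot 0=0$), and $$J_{p,f}(u)=\frac12\int_\Omega|\nabla u|^2\,dx+\frac12\left(\int_\Omega|u|^{\frac{2p}{p+1}}\,dx\right)^{\frac{p+1}{p}}-\langle f,u\rangle ,\qquad u\in W^{1,2}_0(\Omega)$$ (with value $+\infty$ if $u\notin L^{2p/(p+1)}(\Omega)$).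 Call $V$ admissible if $V\ge 0$ and $\int_\Omega V^{-p}\,dx\le 1$. Then the following holds. (a) Let $\Omega\subset\mathbb{R}^N$ be open and $f\in W^{-1,2}(\Omega)$ with $f\neq 0$. Let $U_0$ be the minimiser of $\mathcal{E}_f$ among all admissible potentials, let $u_0$ be the minimiser of $J_{p,f}$ over $W^{1,2}_0(\Omega)$, and suppose that $$c_4:=\left\||u_0|^{\frac{p-1}{p+1}}\right\|_{L^{(2^*)'}(\Omega)}<+\infty .$$ Then for every admissible potential $V$ $$\mathcal{E}_f(V)-\mathcal{E}_f(U_0)\ \ge\ \sigma_m\,\left\|\frac1V-\frac1{U_0}\right\|_{L^p(\Omega)}^{\frac{2p(p+1)}{p-1}},$$ where $\sigma_m>0$ is a constant depending only on $N$, $p$, $c_2:=\left(\int_\Omega|u_0|^{\frac{2p}{p+1}}\,dx\right)^{\frac{p+1}{2p}}$, $c_4$ and $\|f\|_{W^{-1,2}(\Omega)}$. (b) If $|\Omega|<+\infty$, the condition $c_4<+\infty$ holds for every $f\in W^{-1,2}(\Omega)$. -/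

import Mathlib

open MeasureTheory Set
open scoped ENNReal NNReal ContDiff

noncomputable section

namespace SchrodingerStability

/-- The Sobolev exponent `2^* = 2N/(N-2)`, used only for `N ≥ 3`. -/
def twoStar (N : ℕ) : ℝ := 2 * (N : ℝ) / ((N : ℝ) - 2)

theorem one_le_twoStar (N : ℕ) [hN : Fact (3 ≤ N)] : 1 ≤ twoStar N := by
  have h : (3 : ℝ) ≤ N := by exact_mod_cast hN.out
  rw [twoStar, le_div_iff₀ (by linarith)]
  linarith

instance fact_one_le_twoStar (N : ℕ) [Fact (3 ≤ N)] :
    Fact ((1 : ℝ≥0∞) ≤ ENNReal.ofReal (twoStar N)) :=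
  ⟨by simpa using ENNReal.ofReal_le_ofReal (one_le_twoStar N)⟩

/-- The functions of class `C^∞_0(Ω)`: smooth, with compact support contained in `Ω`. -/
structure IsTestFunction {N : ℕ} (Ω : Set (EuclideanSpace ℝ (Fin N)))
    (φ : EuclideanSpace ℝ (Fin N) → ℝ) : Prop where
  smooth : ContDiff ℝ ∞ φ
  compact : HasCompactSupport φ
  support : tsupport φ ⊆ Ω

/-- The pairs `(φ, ∇φ)` with `φ ∈ C^∞_0(Ω)`, as a subspace of
`L^{2^*}(ℝ^N) × L²(ℝ^N; ℝ^N)`. -/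
def testGraph (N : ℕ) [Fact (3 ≤ N)] (Ω : Set (EuclideanSpace ℝ (Fin N))) :
    Submodule ℝ (Lp ℝ (ENNReal.ofReal (twoStar N)) (volume : Measure (EuclideanSpace ℝ (Fin N))) ×
      Lp (EuclideanSpace ℝ (Fin N)) 2 (volume : Measure (EuclideanSpace ℝ (Fin N)))) where
  carrier := {w | ∃ φ, IsTestFunction Ω φ ∧ w.1 =ᵐ[volume] φ ∧ w.2 =ᵐ[volume] gradient φ}
  zero_mem' := by
    refine ⟨fun _ => 0, ⟨contDiff_const, HasCompactSupport.zero, ?_⟩, ?_, ?_⟩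
    · simp [tsupport, Function.support]
    · exact Lp.coeFn_zero _ _ _
    · refine (Lp.coeFn_zero _ _ _).trans (Filter.Eventually.of_forall fun x => ?_)
      simp [gradient]
  add_mem' := by
    rintro a b ⟨φ, hφ, h1, h2⟩ ⟨ψ, hψ, h3, h4⟩
    refine ⟨φ + ψ, ⟨hφ.smooth.add hψ.smooth, hφ.compact.add hψ.compact, ?_⟩, ?_, ?_⟩
    · exact (tsupport_add φ ψ).trans (union_subset hφ.support hψ.support)
    · exact (Lp.coeFn_add _ _).trans (h1.add h3)
    · refine (Lp.coeFn_add _ _).trans ((h2.add h4).trans (Filter.Eventually.of_forall fun x => ?_))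
      have e1 := (hφ.smooth.differentiable (by simp)) x
      have e2 := (hψ.smooth.differentiable (by simp)) x
      simp [gradient, fderiv_add e1 e2]
  smul_mem' := by
    rintro c a ⟨φ, hφ, h1, h2⟩
    refine ⟨c • φ, ⟨hφ.smooth.const_smul c, hφ.compact.smul_left (f := fun _ => c), ?_⟩, ?_, ?_⟩
    · exact (closure_mono (Function.support_const_smul_subset c φ)).trans hφ.support
    · exact (Lp.coeFn_smul _ _).trans (h1.const_smul c)
    · refine (Lp.coeFn_smul _ _).trans ((h2.const_smul c).trans
        (Filter.Eventually.of_forall fun x => ?_))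
      have e1 := (hφ.smooth.differentiable (by simp)) x
      simp [gradient, fderiv_const_smul e1]

/-- The homogeneous Sobolev space `W^{1,2}_0(Ω)`, the completion of `C^∞_0(Ω)` for the norm
`‖∇φ‖_{L²}`. Thanks to the Sobolev inequality (`N ≥ 3`) it is realised as a space of functions:
its elements are the pairs `(u, ∇u)` which are limits in `L^{2^*} × L²` of pairs `(φ, ∇φ)` with
`φ ∈ C^∞_0(Ω)`. Such functions are defined on `ℝ^N` and vanish almost everywhere outside `Ω`. -/
def W012 (N : ℕ) [Fact (3 ≤ N)] (Ω : Set (EuclideanSpace ℝ (Fin N))) : Type :=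
  ↥(testGraph N Ω).topologicalClosure

namespace W012

variable {N : ℕ} [Fact (3 ≤ N)] {Ω : Set (EuclideanSpace ℝ (Fin N))}

instance : AddCommGroup (W012 N Ω) :=
  inferInstanceAs (AddCommGroup ↥(testGraph N Ω).topologicalClosure)

instance : Module ℝ (W012 N Ω) :=
  inferInstanceAs (Module ℝ ↥(testGraph N Ω).topologicalClosure)

/-- The inclusion `W^{1,2}_0(Ω) → L^{2^*}(ℝ^N)`, `u ↦ u`. -/
def toLp : W012 N Ω →ₗ[ℝ]
    Lp ℝ (ENNReal.ofReal (twoStar N)) (volume : Measure (EuclideanSpace ℝ (Fin N))) :=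
  (LinearMap.fst ℝ _ _).comp (testGraph N Ω).topologicalClosure.subtype

/-- The weak gradient `W^{1,2}_0(Ω) → L²(ℝ^N; ℝ^N)`, `u ↦ ∇u`. -/
def grad : W012 N Ω →ₗ[ℝ]
    Lp (EuclideanSpace ℝ (Fin N)) 2 (volume : Measure (EuclideanSpace ℝ (Fin N))) :=
  (LinearMap.snd ℝ _ _).comp (testGraph N Ω).topologicalClosure.subtype

/-- The Sobolev inequality on `W^{1,2}_0(Ω)`. -/
theorem exists_norm_toLp_le (N : ℕ) [hN : Fact (3 ≤ N)] (Ω : Set (EuclideanSpace ℝ (Fin N))) :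
    ∃ C : ℝ, ∀ u : W012 N Ω, ‖toLp u‖ ≤ C * ‖grad u‖ := by
  have h3 : (3 : ℝ) ≤ N := by exact_mod_cast hN.out
  let C : ℝ≥0 := eLpNormLESNormFDerivOfEqInnerConst
    (volume : Measure (EuclideanSpace ℝ (Fin N))) ((2 : ℝ≥0) : ℝ)
  refine ⟨C, fun u => ?_⟩
  have hcl : IsClosed {w : Lp ℝ (ENNReal.ofReal (twoStar N))
      (volume : Measure (EuclideanSpace ℝ (Fin N))) ×
      Lp (EuclideanSpace ℝ (Fin N)) 2 (volume : Measure (EuclideanSpace ℝ (Fin N))) |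
      ‖w.1‖ ≤ C * ‖w.2‖} :=
    isClosed_le (by fun_prop) (by fun_prop)
  refine closure_minimal ?_ hcl u.2
  rintro w ⟨φ, hφ, h1, h2⟩
  have key := eLpNorm_le_eLpNorm_fderiv_of_eq_inner
    (μ := (volume : Measure (EuclideanSpace ℝ (Fin N)))) (u := φ) (p := 2)
    (p' := (twoStar N).toNNReal)
    (hφ.smooth.of_le (by simp)) hφ.compact (by norm_num)
    (by rw [finrank_euclideanSpace_fin]; have := hN.out; omega)
    (by
      rw [finrank_euclideanSpace_fin,
        Real.coe_toNNReal _ (zero_le_one.trans (one_le_twoStar N)), twoStar]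
      have : (N : ℝ) - 2 ≠ 0 := by linarith
      have : (N : ℝ) ≠ 0 := by linarith
      push_cast
      field_simp)
  have e2 : eLpNorm (fderiv ℝ φ) ((2 : ℝ≥0) : ℝ≥0∞) volume = eLpNorm w.2 2 volume := by
    refine (eLpNorm_congr_norm_ae ?_).trans (eLpNorm_congr_ae h2).symm
    exact Filter.Eventually.of_forall fun x => by simp [gradient]
  change ‖w.1‖ ≤ C * ‖w.2‖
  rw [Lp.norm_def, Lp.norm_def, eLpNorm_congr_ae h1, ← e2, ← ENNReal.coe_toReal C,
    ← ENNReal.toReal_mul]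
  refine ENNReal.toReal_mono (ENNReal.mul_ne_top ENNReal.coe_ne_top ?_) key
  rw [e2]
  exact Lp.eLpNorm_ne_top _

theorem grad_injective : Function.Injective (grad : W012 N Ω →ₗ[ℝ] _) := by
  rw [← LinearMap.ker_eq_bot, LinearMap.ker_eq_bot']
  intro u hu
  obtain ⟨C, hC⟩ := exists_norm_toLp_le N Ω
  have h := hC u
  rw [hu, norm_zero, mul_zero] at h
  exact Subtype.ext (Prod.ext (norm_le_zero_iff.mp h) hu)

/-- The norm of `W^{1,2}_0(Ω)` is `‖u‖ = (∫ |∇u|²)^{1/2}`. -/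
instance : NormedAddCommGroup (W012 N Ω) :=
  NormedAddCommGroup.induced _ _ (grad : W012 N Ω →ₗ[ℝ] _) grad_injective

instance : NormedSpace ℝ (W012 N Ω) :=
  NormedSpace.induced ℝ _ _ (grad : W012 N Ω →ₗ[ℝ] _)

instance : CoeFun (W012 N Ω) fun _ => EuclideanSpace ℝ (Fin N) → ℝ :=
  ⟨fun u => toLp u⟩

theorem norm_eq (u : W012 N Ω) : ‖u‖ = ‖grad u‖ := rfl

end W012

section Energies

variable {N : ℕ} [Fact (3 ≤ N)] {Ω : Set (EuclideanSpace ℝ (Fin N))}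

/-- The functional `½ ∫_Ω |∇u|² + ½ ∫_Ω V u² - ⟨f, u⟩ ∈ (-∞, +∞]` on `W^{1,2}_0(Ω)`, for a
potential `0 ≤ V ≤ +∞` and `f` in the dual space `W^{-1,2}(Ω)`. Here `∞ * 0 = 0`. -/
def schrodingerFunctional (f : StrongDual ℝ (W012 N Ω)) (V : EuclideanSpace ℝ (Fin N) → ℝ≥0∞)
    (u : W012 N Ω) : EReal :=
  ((‖u‖ ^ 2 / 2 - f u : ℝ) : EReal) +
    (((∫⁻ x in Ω, V x * ENNReal.ofReal (u x ^ 2)) / 2 : ℝ≥0∞) : EReal)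

/-- The energy `E_f(V)`: the minimal value of the functional above. -/
def energy (f : StrongDual ℝ (W012 N Ω)) (V : EuclideanSpace ℝ (Fin N) → ℝ≥0∞) : EReal :=
  ⨅ u : W012 N Ω, schrodingerFunctional f V u

/-- `V : Ω → [0, +∞]` is measurable and `∫_Ω V^{-p} ≤ 1` (where `0^{-p} = ∞` and `∞^{-p} = 0`).
The values of `V` outside `Ω` play no role. -/
structure IsAdmissible (Ω : Set (EuclideanSpace ℝ (Fin N))) (p : ℝ)
    (V : EuclideanSpace ℝ (Fin N) → ℝ≥0∞) : Prop where
  measurable : AEMeasurable V (volume.restrict Ω)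
  integral_le : ∫⁻ x in Ω, V x ^ (-p) ≤ 1

/-- `U₀` minimises `E_f` among the admissible potentials. -/
structure IsOptimalPotential (p : ℝ) (f : StrongDual ℝ (W012 N Ω))
    (U₀ : EuclideanSpace ℝ (Fin N) → ℝ≥0∞) : Prop where
  admissible : IsAdmissible Ω p U₀
  energy_le : ∀ V, IsAdmissible Ω p V → energy f U₀ ≤ energy f V

/-- The functional
`J_{p,f}(u) = ½ ∫_Ω |∇u|² + ½ (∫_Ω |u|^{2p/(p+1)})^{(p+1)/p} - ⟨f, u⟩ ∈ (-∞, +∞]`. -/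
def J (p : ℝ) (f : StrongDual ℝ (W012 N Ω)) (u : W012 N Ω) : EReal :=
  ((‖u‖ ^ 2 / 2 - f u : ℝ) : EReal) +
    (((∫⁻ x in Ω, ‖u x‖ₑ ^ (2 * p / (p + 1))) ^ ((p + 1) / p) / 2 : ℝ≥0∞) : EReal)

/-- `u₀` minimises `J_{p,f}` over `W^{1,2}_0(Ω)`. -/
def IsOptimalFunction (p : ℝ) (f : StrongDual ℝ (W012 N Ω)) (u₀ : W012 N Ω) : Prop :=
  ∀ u : W012 N Ω, J p f u₀ ≤ J p f u

/-- `c₂ = (∫_Ω |u|^{2p/(p+1)})^{(p+1)/(2p)}`. -/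
def c₂ (p : ℝ) (u : W012 N Ω) : ℝ≥0∞ :=
  (∫⁻ x in Ω, ‖u x‖ₑ ^ (2 * p / (p + 1))) ^ ((p + 1) / (2 * p))

/-- `c₄ = ‖ |u|^{(p-1)/(p+1)} ‖_{L^{(2^*)'}(Ω)}`, with `(2^*)'` the conjugate exponent of
`2^*`. -/
def c₄ (p : ℝ) (u : W012 N Ω) : ℝ≥0∞ :=
  eLpNorm (fun x => |u x| ^ ((p - 1) / (p + 1))) (ENNReal.ofReal (twoStar N).conjExponent)
    (volume.restrict Ω)

/-- `‖1/V - 1/U‖_{L^p(Ω)}`, where `1/∞ = 0`. For admissible `V`, `U` the functions `1/V`, `1/U`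
are finite almost everywhere in `Ω`. -/
def invDist (Ω : Set (EuclideanSpace ℝ (Fin N))) (p : ℝ)
    (V U : EuclideanSpace ℝ (Fin N) → ℝ≥0∞) : ℝ :=
  (eLpNorm (fun x => ((V x)⁻¹).toReal - ((U x)⁻¹).toReal) (ENNReal.ofReal p)
    (volume.restrict Ω)).toReal

end Energies

end SchrodingerStability

end

/-! Write `a = c₂ p u₀`. The potential `P = powerPotential p u₀`, with inverse `(|u₀|/a)^{2/(p+1)}`,
is admissible and gives equality in Hölder's inequality, so the energy of `P` is at most `J(u₀)`. It
remains to bound the Schrödinger functional of any admissible `V` at any `u` from below by `J(u₀)`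
plus a power of the distance `D` between `1/V` and `1/P`.

Test the minimality of `u₀` with `m = (u + u₀)/2`, and let `W` be the harmonic mean of `V` and `P`.
Hölder (`lintegral_enorm_rpow_le`) bounds `c₂(m)²` by `L ∫ W m²` with `L = (∫ W^{-p})^{1/p}`; joint
convexity of `u²/w` (`harmonicMean_mul_sq_le`) bounds `∫ W m²`; the parallelogram law handles the
gradients. The gap is therefore at least `(1 - L) c₂(m)² + ‖u - u₀‖²/4`
(`IsOptimalFunction.energy_gap`). Uniform convexity of `L^p` (`lintegral_harmonicMean_add_le`) gives
`1 - L ≥ κ D^{2p}/p`.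

The factor `c₂(m)` must not degenerate. By `c₂_rpow_le`, finiteness of `c₄` forces `c₂(m) ≥ a/2`
when `u` is close to `u₀` in the Dirichlet norm; otherwise the quadratic term alone suffices. This
gives the exponent `2p`, hence the larger one since `κ D^{2p} ≤ 1`. Applied to `V = U₀`, the same
estimate shows `1/U₀ = 1/P` almost everywhere. -/

namespace SchrodingerStability

/-! ### Quantitative convexity of powers and of `L^p`. -/

section PowerMeans

/-- The difference of the two sides is increasing in `t`. The coefficient is half the Taylor one,
which leaves room for a crude Bernoulli bound valid for every `p > 1`. -/
theorem one_add_sq_le_half_rpow_add_rpow {p t : ℝ} (hp : 1 < p) (ht₀ : 0 ≤ t) (ht₁ : t ≤ 1) :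
    1 + p * (p - 1) / 4 * t ^ 2 ≤ ((1 + t) ^ p + (1 - t) ^ p) / 2 := by
  let g : ℝ → ℝ := fun s => ((1 + s) ^ p + (1 - s) ^ p) / 2 - p * (p - 1) / 4 * s ^ 2
  have hd : ∀ s : ℝ, HasDerivAt g
      ((p * (1 + s) ^ (p - 1) - p * (1 - s) ^ (p - 1)) / 2 - p * (p - 1) / 4 * (2 * s)) s := by
    intro s
    have h1 : HasDerivAt (fun s : ℝ => (1 + s) ^ p) (p * (1 + s) ^ (p - 1)) s := by
      simpa using ((hasDerivAt_id s).const_add 1).rpow_const (p := p) (Or.inr hp.le)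
    have h2 : HasDerivAt (fun s : ℝ => (1 - s) ^ p) (-(p * (1 - s) ^ (p - 1))) s := by
      simpa using ((hasDerivAt_id s).const_sub 1).rpow_const (p := p) (Or.inr hp.le)
    have h3 : HasDerivAt (fun s : ℝ => s ^ 2) (2 * s) s := by
      simpa using hasDerivAt_pow 2 s
    exact ((h1.add h2).div_const 2).sub (h3.const_mul _) |>.congr_deriv (by ring)
  have hmono : MonotoneOn g (Icc 0 1) := by
    refine monotoneOn_of_deriv_nonneg (convex_Icc 0 1)
      (fun s _ => (hd s).continuousAt.continuousWithinAt)
      (fun s _ => (hd s).differentiableAt.differentiableWithinAt) fun s hs => ?_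
    rw [interior_Icc] at hs
    rw [(hd s).deriv]
    -- Bernoulli applies to one of the two powers, depending on whether `p - 1` is above or below
    -- `1`; the other is compared with `1`.
    have key : (p - 1) * s ≤ (1 + s) ^ (p - 1) - (1 - s) ^ (p - 1) := by
      rcases le_total 1 (p - 1) with h | h
      · have h1 := one_add_mul_self_le_rpow_one_add (s := s) (by linarith [hs.1]) h
        have h2 : (1 - s) ^ (p - 1) ≤ 1 :=
          Real.rpow_le_one (by linarith [hs.2]) (by linarith [hs.1]) (by linarith)
        linarith
      · have h1 := rpow_one_add_le_one_add_mul_self (s := -s) (by linarith [hs.2])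
          (sub_nonneg.2 hp.le) h
        have h2 : 1 ≤ (1 + s) ^ (p - 1) :=
          Real.one_le_rpow (by linarith [hs.1]) (by linarith)
        rw [← sub_eq_add_neg] at h1
        linarith
    have := mul_le_mul_of_nonneg_left key (show 0 ≤ p / 2 by linarith)
    linarith
  have := hmono (left_mem_Icc.2 zero_le_one) ⟨ht₀, ht₁⟩ ht₀
  simp only [g, add_zero, Real.one_rpow, sub_zero] at this
  norm_num at this
  linarith

/-- A quantitative form of the strict convexity of `x ↦ x ^ p`. -/
theorem sq_abs_sub_rpow_le {p a b : ℝ} (hp : 1 < p) (ha : 0 ≤ a) (hb : 0 ≤ b) :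
    p * (p - 1) / 4 * (|a - b| ^ p) ^ 2 ≤
      (2 ^ p) ^ 2 * (((a ^ p + b ^ p) / 2 - ((a + b) / 2) ^ p) * ((a + b) / 2) ^ p) := by
  wlog hab : b ≤ a generalizing a b
  · have := this hb ha (le_of_not_ge hab)
    rwa [abs_sub_comm, add_comm b a, add_comm (b ^ p)] at this
  rcases (add_nonneg ha hb).eq_or_lt with h0 | h0
  · obtain rfl : a = 0 := by linarith
    obtain rfl : b = 0 := by linarith
    simp [Real.zero_rpow (by linarith : p ≠ 0)]
  -- By homogeneity, reduce to `a = m(1 + t)`, `b = m(1 - t)` with `t` in `[0, 1]`.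
  obtain ⟨m, hm⟩ : ∃ m, m = (a + b) / 2 := ⟨_, rfl⟩
  obtain ⟨t, ht⟩ : ∃ t, t = (a - b) / (a + b) := ⟨_, rfl⟩
  have hm0 : 0 < m := by linarith
  have ht0 : 0 ≤ t := ht ▸ div_nonneg (by linarith) h0.le
  have ht1 : t ≤ 1 := ht ▸ (div_le_one h0).2 (by linarith)
  have hmt : m * t = (a - b) / 2 := by rw [hm, ht]; field_simp
  have h1 : a = m * (1 + t) := by linarith
  have h2 : b = m * (1 - t) := by linarith
  have key := one_add_sq_le_half_rpow_add_rpow hp ht0 ht1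
  have h3 : |a - b| ^ p = 2 ^ p * m ^ p * t ^ p := by
    rw [abs_of_nonneg (by linarith), ← Real.mul_rpow zero_le_two hm0.le,
      ← Real.mul_rpow (by positivity) ht0]
    congr 1; linarith
  rw [← hm, h3, h1, h2, Real.mul_rpow hm0.le (by linarith), Real.mul_rpow hm0.le (by linarith)]
  have htp : t ^ p ≤ t := by
    simpa using Real.rpow_le_rpow_of_exponent_ge' ht0 ht1 zero_le_one hp.le
  have htp0 : 0 ≤ t ^ p := Real.rpow_nonneg ht0 p
  have h4 : p * (p - 1) / 4 * (t ^ p) ^ 2 ≤ ((1 + t) ^ p + (1 - t) ^ p) / 2 - 1 := by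
    have : (t ^ p) ^ 2 ≤ t ^ 2 := by gcongr
    have hp' : 0 ≤ p * (p - 1) / 4 := by nlinarith
    nlinarith [mul_le_mul_of_nonneg_left this hp']
  have h5 := mul_le_mul_of_nonneg_left h4 (show 0 ≤ (2 ^ p * m ^ p) ^ 2 by positivity)
  nlinarith [h5]

theorem half_add_rpow_le {p a b : ℝ} (hp : 1 < p) (ha : 0 ≤ a) (hb : 0 ≤ b) :
    ((a + b) / 2) ^ p ≤ (a ^ p + b ^ p) / 2 := by
  have := (convexOn_rpow hp.le).2 (mem_Ici.2 ha) (mem_Ici.2 hb)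
    (by norm_num : (0 : ℝ) ≤ 1 / 2) (by norm_num : (0 : ℝ) ≤ 1 / 2) (by norm_num)
  simp only [smul_eq_mul] at this
  rw [show (a + b) / 2 = 1 / 2 * a + 1 / 2 * b by ring]
  linarith

/-- Uniform convexity of the unit ball of `L^p`, on nonnegative functions. -/
theorem lintegral_half_add_rpow_add_le {α : Type*} [MeasurableSpace α] {μ : Measure α} {p : ℝ}
    (hp : 1 < p) {a b : α → ℝ} (ha : AEMeasurable a μ) (hb : AEMeasurable b μ)
    (ha₀ : ∀ x, 0 ≤ a x) (hb₀ : ∀ x, 0 ≤ b x)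
    (ha₁ : ∫⁻ x, ENNReal.ofReal (a x ^ p) ∂μ ≤ 1) (hb₁ : ∫⁻ x, ENNReal.ofReal (b x ^ p) ∂μ ≤ 1) :
    ∫⁻ x, ENNReal.ofReal (((a x + b x) / 2) ^ p) ∂μ +
      ENNReal.ofReal (p * (p - 1) / 4 / (2 ^ p) ^ 2) *
        (∫⁻ x, ENNReal.ofReal (|a x - b x| ^ p) ∂μ) ^ 2 ≤ 1 := by
  obtain ⟨κ, hκ⟩ : ∃ κ, κ = p * (p - 1) / 4 / (2 ^ p) ^ 2 := ⟨_, rfl⟩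
  have hκ0 : 0 < κ := by
    rw [hκ]; have : 0 < p * (p - 1) := mul_pos (by linarith) (by linarith)
    positivity
  rw [← hκ]
  let m : α → ℝ := fun x => ((a x + b x) / 2) ^ p
  let g : α → ℝ := fun x => (a x ^ p + b x ^ p) / 2 - m x
  have hm0 : ∀ x, 0 ≤ m x := fun x => by have := ha₀ x; have := hb₀ x; positivity
  have hg0 : ∀ x, 0 ≤ g x := fun x => sub_nonneg.2 (half_add_rpow_le hp (ha₀ x) (hb₀ x))
  have hmm : AEMeasurable m μ := by fun_prop
  have hgm : AEMeasurable g μ := by fun_prop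
  have hsum : ∫⁻ x, ENNReal.ofReal (m x) ∂μ + ∫⁻ x, ENNReal.ofReal (g x) ∂μ ≤ 1 := by
    rw [← lintegral_add_left' hmm.ennreal_ofReal]
    calc ∫⁻ x, (ENNReal.ofReal (m x) + ENNReal.ofReal (g x)) ∂μ
        = ∫⁻ x, (ENNReal.ofReal (1 / 2) * ENNReal.ofReal (a x ^ p) +
            ENNReal.ofReal (1 / 2) * ENNReal.ofReal (b x ^ p)) ∂μ := by
          refine lintegral_congr fun x => ?_
          have h1 := Real.rpow_nonneg (ha₀ x) p
          have h2 := Real.rpow_nonneg (hb₀ x) p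
          rw [← ENNReal.ofReal_add (hm0 x) (hg0 x), ← ENNReal.ofReal_mul (by norm_num),
            ← ENNReal.ofReal_mul (by norm_num), ← ENNReal.ofReal_add (by positivity)
              (by positivity)]
          congr 1
          simp only [g]; ring
      _ = ENNReal.ofReal (1 / 2) * ∫⁻ x, ENNReal.ofReal (a x ^ p) ∂μ +
            ENNReal.ofReal (1 / 2) * ∫⁻ x, ENNReal.ofReal (b x ^ p) ∂μ := by
          rw [lintegral_add_left' (by fun_prop), lintegral_const_mul' _ _ (by simp),
            lintegral_const_mul' _ _ (by simp)]
      _ ≤ ENNReal.ofReal (1 / 2) * 1 + ENNReal.ofReal (1 / 2) * 1 := by gcongr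
      _ = 1 := by
          rw [mul_one, ← ENNReal.ofReal_add (by norm_num) (by norm_num)]; norm_num
  -- Pointwise, `|a - b|^p` is at most a constant times the geometric mean of the convexity defect
  -- `g` and of `m`. Cauchy–Schwarz then applies, with `∫ m ≤ 1`.
  have hD : (ENNReal.ofReal κ) * (∫⁻ x, ENNReal.ofReal (|a x - b x| ^ p) ∂μ) ^ 2 ≤
      ∫⁻ x, ENNReal.ofReal (g x) ∂μ := by
    have hpt : ∀ x, ENNReal.ofReal (|a x - b x| ^ p) ≤
        ENNReal.ofReal (κ⁻¹) ^ (1 / 2 : ℝ) *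
          (ENNReal.ofReal (g x) ^ (1 / 2 : ℝ) * ENNReal.ofReal (m x) ^ (1 / 2 : ℝ)) := by
      intro x
      have h0 : 0 ≤ |a x - b x| ^ p := by positivity
      rw [← ENNReal.mul_rpow_of_nonneg _ _ (by norm_num),
        ← ENNReal.mul_rpow_of_nonneg _ _ (by norm_num), ← ENNReal.ofReal_mul (hg0 x),
        ← ENNReal.ofReal_mul (by positivity), ENNReal.ofReal_rpow_of_nonneg
          (mul_nonneg (by positivity) (mul_nonneg (hg0 x) (hm0 x))) (by norm_num),
        ← Real.sqrt_eq_rpow]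
      refine ENNReal.ofReal_le_ofReal (Real.le_sqrt_of_sq_le ?_)
      have := sq_abs_sub_rpow_le hp (ha₀ x) (hb₀ x)
      rw [inv_mul_eq_div, le_div_iff₀ hκ0, hκ, mul_div_assoc', div_le_iff₀ (by positivity)]
      simp only [g, m]
      linarith
    have h1 : ∫⁻ x, ENNReal.ofReal (|a x - b x| ^ p) ∂μ ≤
        ENNReal.ofReal (κ⁻¹) ^ (1 / 2 : ℝ) * (∫⁻ x, ENNReal.ofReal (g x) ∂μ) ^ (1 / 2 : ℝ) := by
      calc _ ≤ ∫⁻ x, ENNReal.ofReal (κ⁻¹) ^ (1 / 2 : ℝ) *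
          (ENNReal.ofReal (g x) ^ (1 / 2 : ℝ) * ENNReal.ofReal (m x) ^ (1 / 2 : ℝ)) ∂μ :=
            lintegral_mono hpt
        _ = ENNReal.ofReal (κ⁻¹) ^ (1 / 2 : ℝ) * ∫⁻ x,
          ENNReal.ofReal (g x) ^ (1 / 2 : ℝ) * ENNReal.ofReal (m x) ^ (1 / 2 : ℝ) ∂μ :=
            lintegral_const_mul' _ _ (ENNReal.rpow_ne_top_of_nonneg (by norm_num) (by simp))
        _ ≤ ENNReal.ofReal (κ⁻¹) ^ (1 / 2 : ℝ) * ((∫⁻ x, ENNReal.ofReal (g x) ∂μ) ^ (1 / 2 : ℝ) *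
            (∫⁻ x, ENNReal.ofReal (m x) ∂μ) ^ (1 / 2 : ℝ)) := by
            gcongr
            exact ENNReal.lintegral_mul_norm_pow_le hgm.ennreal_ofReal hmm.ennreal_ofReal
              (by norm_num) (by norm_num) (by norm_num)
        _ ≤ ENNReal.ofReal (κ⁻¹) ^ (1 / 2 : ℝ) *
            ((∫⁻ x, ENNReal.ofReal (g x) ∂μ) ^ (1 / 2 : ℝ) * 1) := by
            gcongr
            exact ENNReal.rpow_le_one (le_self_add.trans hsum) (by norm_num)
        _ = _ := by rw [mul_one]
    calc _ ≤ ENNReal.ofReal κ * (ENNReal.ofReal (κ⁻¹) ^ (1 / 2 : ℝ) *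
          (∫⁻ x, ENNReal.ofReal (g x) ∂μ) ^ (1 / 2 : ℝ)) ^ 2 := by gcongr
      _ = ENNReal.ofReal κ * ENNReal.ofReal κ⁻¹ * ∫⁻ x, ENNReal.ofReal (g x) ∂μ := by
          rw [mul_pow, ← ENNReal.rpow_natCast, ← ENNReal.rpow_natCast, ← ENNReal.rpow_mul,
            ← ENNReal.rpow_mul, mul_assoc]
          norm_num
      _ = _ := by
          rw [← ENNReal.ofReal_mul hκ0.le, mul_inv_cancel₀ hκ0.ne', ENNReal.ofReal_one, one_mul]
  exact (add_le_add le_rfl hD).trans hsum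

end PowerMeans

/-! ### Hölder's inequality and joint convexity for potentials. -/

section Potentials

variable {α : Type*} [MeasurableSpace α] {μ : Measure α}

/-- Hölder's inequality behind the optimisation of the potential. -/
theorem lintegral_enorm_rpow_le {p : ℝ} (hp : 1 < p) {V : α → ℝ≥0∞} {u : α → ℝ}
    (hV : AEMeasurable V μ) (hu : AEMeasurable u μ) (hV₁ : ∫⁻ x, V x ^ (-p) ∂μ ≠ ⊤)
    (hVu : ∫⁻ x, V x * ENNReal.ofReal (u x ^ 2) ∂μ ≠ ⊤) :
    (∫⁻ x, ‖u x‖ₑ ^ (2 * p / (p + 1)) ∂μ) ^ ((p + 1) / p) ≤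
      (∫⁻ x, V x ^ (-p) ∂μ) ^ (1 / p) * ∫⁻ x, V x * ENNReal.ofReal (u x ^ 2) ∂μ := by
  have hp0 : 0 < p := by linarith
  have hle : ∫⁻ x, ‖u x‖ₑ ^ (2 * p / (p + 1)) ∂μ ≤ (∫⁻ x, V x ^ (-p) ∂μ) ^ (1 / (p + 1)) *
      (∫⁻ x, V x * ENNReal.ofReal (u x ^ 2) ∂μ) ^ (p / (p + 1)) := by
    refine le_trans (lintegral_mono_ae ?_) (ENNReal.lintegral_mul_norm_pow_le (hV.pow_const (-p))
      (hV.mul (hu.pow_const 2).ennreal_ofReal) (by positivity) (by positivity) (by field_simp; ring))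
    -- Where `u ≠ 0`, finiteness of the two integrals excludes `V = 0` and `V = ∞`, and the powers
    -- of `V` cancel.
    filter_upwards [ae_lt_top' (hV.pow_const (-p)) hV₁,
      ae_lt_top' (hV.mul (hu.pow_const 2).ennreal_ofReal) hVu] with x h1 h2
    have hsq : ENNReal.ofReal (u x ^ 2) = ‖u x‖ₑ ^ (2 : ℝ) := by
      rw [Real.enorm_eq_ofReal_abs, ENNReal.ofReal_rpow_of_nonneg (abs_nonneg _) zero_le_two]
      simp
    simp only [Pi.mul_apply, hsq] at h2 ⊢
    rcases eq_or_ne (u x) 0 with h | h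
    · have : 0 < 2 * p / (p + 1) := by positivity
      simp [h, ENNReal.zero_rpow_of_pos this]
    have hu' : ‖u x‖ₑ ^ (2 : ℝ) ≠ 0 := by simp [h]
    have hV0 : V x ≠ 0 := by
      intro h0; rw [h0, ENNReal.zero_rpow_of_neg (by linarith)] at h1; exact lt_irrefl _ h1
    have hVt : V x ≠ ⊤ := by
      intro h0; rw [h0, ENNReal.top_mul hu'] at h2; exact lt_irrefl _ h2
    rw [ENNReal.mul_rpow_of_nonneg _ _ (by positivity), ← ENNReal.rpow_mul, ← ENNReal.rpow_mul,
      ← mul_assoc, ← ENNReal.rpow_add _ _ hV0 hVt,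
      show -p * (1 / (p + 1)) + p / (p + 1) = 0 by ring, ENNReal.rpow_zero, one_mul, mul_div_assoc]
  calc _ ≤ ((∫⁻ x, V x ^ (-p) ∂μ) ^ (1 / (p + 1)) *
      (∫⁻ x, V x * ENNReal.ofReal (u x ^ 2) ∂μ) ^ (p / (p + 1))) ^ ((p + 1) / p) := by gcongr
    _ = _ := by
      rw [ENNReal.mul_rpow_of_nonneg _ _ (by positivity), ← ENNReal.rpow_mul, ← ENNReal.rpow_mul,
        show 1 / (p + 1) * ((p + 1) / p) = 1 / p by field_simp,
        show p / (p + 1) * ((p + 1) / p) = 1 by field_simp, ENNReal.rpow_one]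

/-- The potential whose inverse is the mean of the inverses of two given potentials. -/
noncomputable def harmonicMean {α : Type*} (V W : α → ℝ≥0∞) : α → ℝ≥0∞ :=
  fun x => (((V x)⁻¹ + (W x)⁻¹) / 2)⁻¹

/-- Joint convexity of `(u, w) ↦ u² / w`. -/
theorem harmonicMean_mul_sq_le {α : Type*} (V W : α → ℝ≥0∞) (u v : α → ℝ) (x : α) :
    harmonicMean V W x * ENNReal.ofReal (((u x + v x) / 2) ^ 2) ≤
      (V x * ENNReal.ofReal (u x ^ 2) + W x * ENNReal.ofReal (v x ^ 2)) / 2 := by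
  unfold harmonicMean
  generalize V x = a, W x = b, u x = s, v x = t
  have h2t : (2 : ℝ≥0∞) ≠ ⊤ := by simp
  rcases eq_or_ne a 0 with rfl | ha0
  · simp [ENNReal.top_div_of_ne_top h2t]
  rcases eq_or_ne b 0 with rfl | hb0
  · simp [ENNReal.top_div_of_ne_top h2t]
  -- The case where one potential is infinite and its function vanishes, so that only the other term
  -- survives.
  have aux : ∀ (b : ℝ≥0∞) (t : ℝ), (b⁻¹ / 2)⁻¹ * ENNReal.ofReal ((t / 2) ^ 2) ≤
      b * ENNReal.ofReal (t ^ 2) / 2 := by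
    intro b t
    rw [ENNReal.inv_div (by simp) (by simp), show (t / 2) ^ 2 = 1 / 2 * (1 / 2) * t ^ 2 by ring,
      ENNReal.ofReal_mul (by norm_num), ENNReal.ofReal_mul (by norm_num), one_div,
      ENNReal.ofReal_inv_of_pos (by norm_num), div_eq_mul_inv, div_eq_mul_inv, inv_inv]
    simp only [ENNReal.ofReal_ofNat]
    rw [show (2 * b * (2⁻¹ * 2⁻¹ * ENNReal.ofReal (t ^ 2)) : ℝ≥0∞) =
      (2 * 2⁻¹) * (b * ENNReal.ofReal (t ^ 2) * 2⁻¹) by ring,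
      ENNReal.mul_inv_cancel (by simp) (by simp), one_mul]
  rcases eq_or_ne a ⊤ with rfl | hat
  · rcases eq_or_ne s 0 with rfl | hs
    · simpa using aux b t
    · rw [ENNReal.top_mul (by simpa using by positivity), top_add,
        ENNReal.top_div_of_ne_top h2t]
      exact le_top
  rcases eq_or_ne b ⊤ with rfl | hbt
  · rcases eq_or_ne t 0 with rfl | hs
    · simpa using aux a s
    · rw [ENNReal.top_mul (by simpa using by positivity), add_top,
        ENNReal.top_div_of_ne_top h2t]
      exact le_top
  lift a to ℝ≥0 using hat
  lift b to ℝ≥0 using hbt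
  have ha : (0 : ℝ) < a := by exact_mod_cast pos_iff_ne_zero.2 (by simpa using ha0)
  have hb : (0 : ℝ) < b := by exact_mod_cast pos_iff_ne_zero.2 (by simpa using hb0)
  have e1 : (((a : ℝ≥0∞)⁻¹ + (b : ℝ≥0∞)⁻¹) / 2)⁻¹ =
      ENNReal.ofReal ((((a : ℝ)⁻¹ + (b : ℝ)⁻¹) / 2)⁻¹) := by
    rw [ENNReal.ofReal_inv_of_pos (by positivity), ENNReal.ofReal_div_of_pos (by positivity),
      ENNReal.ofReal_add (by positivity) (by positivity), ENNReal.ofReal_inv_of_pos ha,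
      ENNReal.ofReal_inv_of_pos hb]
    simp
  rw [e1, ← ENNReal.ofReal_mul (by positivity), ← ENNReal.ofReal_coe_nnreal (p := a),
    ← ENNReal.ofReal_coe_nnreal (p := b), ← ENNReal.ofReal_mul (by positivity),
    ← ENNReal.ofReal_mul (by positivity), ← ENNReal.ofReal_add (by positivity) (by positivity),
    ← ENNReal.ofReal_ofNat, ← ENNReal.ofReal_div_of_pos (by norm_num)]
  refine ENNReal.ofReal_le_ofReal ?_
  rw [← sub_nonneg]
  -- The convexity defect is an explicit square.
  have : ((a : ℝ) * s ^ 2 + b * t ^ 2) / 2 - (((a : ℝ)⁻¹ + (b : ℝ)⁻¹) / 2)⁻¹ * ((s + t) / 2) ^ 2 =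
      (a * s - b * t) ^ 2 / (2 * (a + b)) := by
    field_simp; ring
  rw [this]; positivity

end Potentials

theorem one_lt_twoStar (N : ℕ) [hN : Fact (3 ≤ N)] : 1 < twoStar N := by
  have h : (3 : ℝ) ≤ N := by exact_mod_cast hN.out
  rw [twoStar, lt_div_iff₀ (by linarith)]
  linarith

instance holderConjugate_twoStar (N : ℕ) [Fact (3 ≤ N)] :
    ENNReal.HolderConjugate (ENNReal.ofReal (twoStar N).conjExponent)
      (ENNReal.ofReal (twoStar N)) :=
  (Real.HolderConjugate.conjExponent (one_lt_twoStar N)).symm.ennrealOfReal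

theorem one_le_conjExponent_twoStar (N : ℕ) [Fact (3 ≤ N)] :
    (1 : ℝ≥0∞) ≤ ENNReal.ofReal (twoStar N).conjExponent :=
  ENNReal.HolderConjugate.one_le _ (ENNReal.ofReal (twoStar N))

/-! ### Properties of the homogeneous Sobolev space. -/

namespace W012

variable {N : ℕ} [Fact (3 ≤ N)] {Ω : Set (EuclideanSpace ℝ (Fin N))}

theorem parallelogram (u v : W012 N Ω) :
    ‖u + v‖ ^ 2 + ‖u - v‖ ^ 2 = 2 * (‖u‖ ^ 2 + ‖v‖ ^ 2) := by
  simp only [norm_eq, map_add, map_sub]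
  exact parallelogram_law_with_norm ℝ _ _

theorem testGraph_mono {Ω' : Set (EuclideanSpace ℝ (Fin N))} (h : Ω ⊆ Ω') :
    testGraph N Ω ≤ testGraph N Ω' := by
  rintro w ⟨φ, hφ, h1, h2⟩
  exact ⟨φ, ⟨hφ.smooth, hφ.compact, hφ.support.trans h⟩, h1, h2⟩

/-- The Sobolev inequality, with a constant that does not depend on the domain. -/
theorem exists_pos_norm_toLp_le (N : ℕ) [Fact (3 ≤ N)] :
    ∃ C : ℝ, 0 < C ∧ ∀ (Ω : Set (EuclideanSpace ℝ (Fin N))) (u : W012 N Ω),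
      ‖toLp u‖ ≤ C * ‖u‖ := by
  -- Each space embeds in the one over `ℝ^N` with the same function and gradient, so the constant
  -- found there serves every domain.
  obtain ⟨C, hC⟩ := exists_norm_toLp_le N univ
  refine ⟨|C| + 1, by positivity, fun Ω u => ?_⟩
  have h := hC ⟨u.1, Submodule.topologicalClosure_mono (testGraph_mono (subset_univ Ω)) u.2⟩
  change ‖toLp u‖ ≤ C * ‖u‖ at h
  exact h.trans (mul_le_mul_of_nonneg_right (by linarith [le_abs_self C]) (norm_nonneg u))

/-- Vanishing off `Ω` is a closed condition in `L^{2^*}` and holds for test functions. -/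
theorem ae_eq_zero_of_notMem (hΩ : IsOpen Ω) (u : W012 N Ω) :
    ∀ᵐ x ∂volume.restrict Ωᶜ, u x = 0 := by
  let R := LpToLpRestrictCLM (EuclideanSpace ℝ (Fin N)) ℝ ℝ volume
    (ENNReal.ofReal (twoStar N)) Ωᶜ
  have hcl : IsClosed {w : Lp ℝ (ENNReal.ofReal (twoStar N))
      (volume : Measure (EuclideanSpace ℝ (Fin N))) ×
      Lp (EuclideanSpace ℝ (Fin N)) 2 (volume : Measure (EuclideanSpace ℝ (Fin N))) |
      R w.1 = 0} :=
    isClosed_eq (R.continuous.comp continuous_fst) continuous_const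
  have h0 : R (toLp u) = 0 := by
    refine closure_minimal ?_ hcl u.2
    rintro w ⟨φ, hφ, h1, -⟩
    refine Lp.ext ?_
    filter_upwards [LpToLpRestrictCLM_coeFn (p := ENNReal.ofReal (twoStar N)) ℝ Ωᶜ w.1,
      Lp.coeFn_zero ℝ (ENNReal.ofReal (twoStar N)) (volume.restrict Ωᶜ),
      ae_restrict_of_ae h1, ae_restrict_mem hΩ.measurableSet.compl] with x e1 e2 e3 hx
    rw [e1, e2, e3, Pi.zero_apply]
    exact image_eq_zero_of_notMem_tsupport fun h => hx (hφ.support h)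
  filter_upwards [LpToLpRestrictCLM_coeFn (p := ENNReal.ofReal (twoStar N)) ℝ Ωᶜ (toLp u),
      Lp.coeFn_zero ℝ (ENNReal.ofReal (twoStar N)) (volume.restrict Ωᶜ)] with x e1 e2
  rw [← e1]
  change R (toLp u) x = 0
  rw [h0, e2, Pi.zero_apply]

/-- The gradient of `u` is its weak gradient. -/
theorem integral_mul_grad (u : W012 N Ω) {ψ : EuclideanSpace ℝ (Fin N) → ℝ}
    (hψ : ContDiff ℝ ∞ ψ) (hc : HasCompactSupport ψ) (v : EuclideanSpace ℝ (Fin N)) :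
    ∫ x, ψ x * inner ℝ v (grad u x) = -∫ x, fderiv ℝ ψ x v * u x := by
  have : Fact ((1 : ℝ≥0∞) ≤ ENNReal.ofReal (twoStar N).conjExponent) :=
    ⟨one_le_conjExponent_twoStar N⟩
  have hψv : MemLp (fun x => ψ x • v) 2 (volume : Measure (EuclideanSpace ℝ (Fin N))) :=
    (hψ.continuous.smul continuous_const).memLp_of_hasCompactSupport hc.smul_right
  have hd : MemLp (fun x => fderiv ℝ ψ x v) (ENNReal.ofReal (twoStar N).conjExponent)
      (volume : Measure (EuclideanSpace ℝ (Fin N))) :=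
    ((hψ.continuous_fderiv (by simp)).clm_apply continuous_const).memLp_of_hasCompactSupport
      ((hc.fderiv ℝ).comp_left (g := fun L : EuclideanSpace ℝ (Fin N) →L[ℝ] ℝ => L v) rfl)
  let P := (ContinuousLinearMap.mul ℝ ℝ).lpPairing (volume : Measure (EuclideanSpace ℝ (Fin N)))
    (ENNReal.ofReal (twoStar N).conjExponent) (ENNReal.ofReal (twoStar N)) hd.toLp
  have hP : ∀ w, P w = ∫ x, fderiv ℝ ψ x v * w x := by
    intro w
    rw [ContinuousLinearMap.lpPairing_eq_integral]
    refine integral_congr_ae ?_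
    filter_upwards [hd.coeFn_toLp] with x hx
    simp [hx]
  have hQ : ∀ w : Lp (EuclideanSpace ℝ (Fin N)) 2 (volume : Measure (EuclideanSpace ℝ (Fin N))),
      inner ℝ hψv.toLp w = ∫ x, ψ x * inner ℝ v (w x) := by
    intro w
    rw [L2.inner_def]
    refine integral_congr_ae ?_
    filter_upwards [hψv.coeFn_toLp] with x hx
    simp [hx, inner_smul_left]
  -- Both sides are continuous in the pair `(u, ∇u)`, so it is enough to integrate by parts on test
  -- functions.
  have hcl : IsClosed {w : Lp ℝ (ENNReal.ofReal (twoStar N))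
      (volume : Measure (EuclideanSpace ℝ (Fin N))) ×
      Lp (EuclideanSpace ℝ (Fin N)) 2 (volume : Measure (EuclideanSpace ℝ (Fin N))) |
      inner ℝ hψv.toLp w.2 = -P w.1} :=
    isClosed_eq (by fun_prop) (P.continuous.comp continuous_fst).neg
  rw [← hP, ← hQ]
  refine closure_minimal ?_ hcl u.2
  rintro w ⟨φ, hφ, h1, h2⟩
  change inner ℝ hψv.toLp w.2 = -P w.1
  rw [hP, hQ]
  have e1 : ∫ x, ψ x * inner ℝ v (w.2 x) = ∫ x, ψ x * fderiv ℝ φ x v := by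
    refine integral_congr_ae ?_
    filter_upwards [h2] with x hx
    rw [hx, gradient, real_inner_comm, InnerProductSpace.toDual_symm_apply]
  have e2 : ∫ x, fderiv ℝ ψ x v * w.1 x = ∫ x, fderiv ℝ ψ x v * φ x := by
    refine integral_congr_ae ?_
    filter_upwards [h1] with x hx
    simp [hx]
  rw [e1, e2]
  have cφ := hφ.smooth.continuous
  have cφ' := (hφ.smooth.continuous_fderiv (by simp)).clm_apply (continuous_const (y := v))
  have cψ' := (hψ.continuous_fderiv (by simp)).clm_apply (continuous_const (y := v))
  refine integral_mul_fderiv_eq_neg_fderiv_mul_of_integrable ?_ ?_ ?_ ?_ ?_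
  · exact (cψ'.mul cφ).integrable_of_hasCompactSupport hφ.compact.mul_left
  · exact (hψ.continuous.mul cφ').integrable_of_hasCompactSupport hc.mul_right
  · exact (hψ.continuous.mul cφ).integrable_of_hasCompactSupport hc.mul_right
  · exact fun x _ => hψ.differentiable (by simp) x
  · exact fun x _ => hφ.smooth.differentiable (by simp) x

/-- Closability of the gradient: if `u = 0`, the weak gradient integrates to zero against every
smooth compactly supported function. -/
theorem toLp_injective : Function.Injective (toLp : W012 N Ω →ₗ[ℝ] _) := by
  rw [← LinearMap.ker_eq_bot, LinearMap.ker_eq_bot']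
  intro u hu
  have hu0 : ∀ᵐ x, u x = 0 := by
    rw [hu]
    exact Lp.coeFn_zero _ _ _
  refine grad_injective ?_
  rw [map_zero]
  refine Lp.ext ?_
  refine Filter.EventuallyEq.trans ?_ (Lp.coeFn_zero _ _ _).symm
  have hcoord : ∀ i, ∀ᵐ x, inner ℝ (EuclideanSpace.single i (1 : ℝ)) (grad u x) = 0 := by
    intro i
    refine ae_eq_zero_of_integral_contDiff_smul_eq_zero ?_ fun ψ hψ hc => ?_
    · have : LocallyIntegrable (grad u) volume := (Lp.memLp (grad u)).locallyIntegrable (by simp)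
      exact fun x => by
        obtain ⟨s, hs, h⟩ := this x
        exact ⟨s, hs, h.const_inner _⟩
    · simp only [smul_eq_mul]
      rw [integral_mul_grad u hψ hc, integral_eq_zero_of_ae, neg_zero]
      filter_upwards [hu0] with x hx
      simp [hx]
  filter_upwards [ae_all_iff.2 hcoord] with x hx
  ext i
  simpa [EuclideanSpace.inner_single_left] using hx i

theorem eq_zero_of_ae_restrict (hΩ : IsOpen Ω) {u : W012 N Ω}
    (hu : ∀ᵐ x ∂volume.restrict Ω, u x = 0) : u = 0 := by
  refine toLp_injective ?_
  rw [map_zero]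
  refine Lp.ext ?_
  refine Filter.EventuallyEq.trans ?_ (Lp.coeFn_zero _ _ _).symm
  exact ae_of_ae_restrict_of_ae_restrict_compl Ω hu (ae_eq_zero_of_notMem hΩ u)

/-- Elements of `W^{1,2}_0(Ω)` that come from test functions. -/
theorem exists_isTestFunction_of_ne_zero {f : StrongDual ℝ (W012 N Ω)} (hf : f ≠ 0) :
    ∃ (v : W012 N Ω) (φ : EuclideanSpace ℝ (Fin N) → ℝ), IsTestFunction Ω φ ∧
      v =ᵐ[volume] φ ∧ f v ≠ 0 := by
  -- A continuous functional vanishing on test functions vanishes on their closure.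
  by_contra! h
  refine hf (ContinuousLinearMap.ext fun u => ?_)
  refine norm_le_zero_iff.1 (le_of_forall_pos_le_add fun ε hε => ?_)
  obtain ⟨w, hw, hd⟩ := Metric.mem_closure_iff.1 u.2 (ε / (‖f‖ + 1)) (by positivity)
  let v : W012 N Ω := ⟨w, Submodule.le_topologicalClosure _ hw⟩
  obtain ⟨φ, hφ, h1, -⟩ := id hw
  have hv : f v = 0 := h v φ hφ h1
  have hle : ‖u - v‖ ≤ ε / (‖f‖ + 1) := by
    refine le_trans ?_ hd.le
    rw [dist_eq_norm]
    exact norm_snd_le (u.1 - w)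
  calc ‖f u‖ = ‖f (u - v)‖ := by rw [map_sub, hv, sub_zero]
    _ ≤ ‖f‖ * ‖u - v‖ := f.le_opNorm _
    _ ≤ (‖f‖ + 1) * (ε / (‖f‖ + 1)) := by gcongr; linarith
    _ = 0 + ε := by field_simp; ring

end W012

/-! ### The functionals, the candidate potential and the energy gap. -/

section Functionals

variable {N : ℕ} [Fact (3 ≤ N)] {Ω : Set (EuclideanSpace ℝ (Fin N))} {p : ℝ}
  {f : StrongDual ℝ (W012 N Ω)}

theorem coe_add_coe_half {r : ℝ} {a : ℝ≥0∞} (ha : a ≠ ⊤) :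
    (r : EReal) + ((a / 2 : ℝ≥0∞) : EReal) = ((r + a.toReal / 2 : ℝ) : EReal) := by
  have h : a / 2 = ENNReal.ofReal (a.toReal / 2) := by
    rw [ENNReal.ofReal_div_of_pos two_pos, ENNReal.ofReal_toReal ha, ENNReal.ofReal_ofNat]
  rw [h, EReal.coe_ennreal_ofReal, max_eq_left (by positivity), EReal.coe_add]

theorem coe_add_coe_top_half (r : ℝ) : (r : EReal) + (((⊤ : ℝ≥0∞) / 2 : ℝ≥0∞) : EReal) = ⊤ := by
  rw [ENNReal.top_div_of_ne_top (by simp), EReal.coe_ennreal_top, EReal.coe_add_top]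

theorem W012.coeFn_smul (c : ℝ) (u : W012 N Ω) :
    (c • u : W012 N Ω) =ᵐ[volume.restrict Ω] fun x => c * u x := by
  refine ae_restrict_of_ae ?_
  filter_upwards [Lp.coeFn_smul c (W012.toLp u)] with x hx
  rw [map_smul, hx]; rfl

theorem W012.coeFn_add (u v : W012 N Ω) :
    (u + v : W012 N Ω) =ᵐ[volume.restrict Ω] fun x => u x + v x := by
  refine ae_restrict_of_ae ?_
  filter_upwards [Lp.coeFn_add (W012.toLp u) (W012.toLp v)] with x hx
  rw [map_add, hx]; rfl

theorem W012.aemeasurable (u : W012 N Ω) : AEMeasurable u (volume.restrict Ω) :=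
  (Lp.aestronglyMeasurable (W012.toLp u)).aemeasurable.restrict

theorem J_zero (hp : 1 < p) : J p f 0 = 0 := by
  have h : ∫⁻ x in Ω, ‖(0 : W012 N Ω) x‖ₑ ^ (2 * p / (p + 1)) = 0 := by
    rw [lintegral_eq_zero_iff' ((W012.aemeasurable 0).enorm.pow_const _)]
    filter_upwards [W012.coeFn_smul (0 : ℝ) (0 : W012 N Ω)] with x hx
    rw [zero_smul] at hx
    have : 0 < 2 * p / (p + 1) := by positivity
    simp [ENNReal.zero_rpow_of_pos this]
  have h2 : 0 < (p + 1) / p := by positivity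
  rw [J, h, ENNReal.zero_rpow_of_pos h2]
  simp

theorem IsOptimalFunction.lintegral_ne_top (hp : 1 < p) {u₀ : W012 N Ω}
    (h : IsOptimalFunction p f u₀) : ∫⁻ x in Ω, ‖u₀ x‖ₑ ^ (2 * p / (p + 1)) ≠ ⊤ := by
  intro ht
  have h0 := h 0
  rw [J_zero hp, J, ht, ENNReal.top_rpow_of_pos (by positivity), coe_add_coe_top_half] at h0
  exact absurd h0 (by simp)

theorem IsOptimalFunction.c₂_ne_top (hp : 1 < p) {u₀ : W012 N Ω}
    (h : IsOptimalFunction p f u₀) : c₂ p u₀ ≠ ⊤ :=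
  ENNReal.rpow_ne_top_of_nonneg (by positivity) (h.lintegral_ne_top hp)

theorem lintegral_eq_c₂_rpow (hp : 1 < p) (u : W012 N Ω) :
    ∫⁻ x in Ω, ‖u x‖ₑ ^ (2 * p / (p + 1)) = c₂ p u ^ (2 * p / (p + 1)) := by
  rw [c₂, ← ENNReal.rpow_mul, show (p + 1) / (2 * p) * (2 * p / (p + 1)) = 1 by field_simp,
    ENNReal.rpow_one]

theorem lintegral_rpow_eq_c₂_sq (hp : 1 < p) (u : W012 N Ω) :
    (∫⁻ x in Ω, ‖u x‖ₑ ^ (2 * p / (p + 1))) ^ ((p + 1) / p) = c₂ p u ^ 2 := by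
  rw [c₂, ← ENNReal.rpow_natCast, ← ENNReal.rpow_mul]
  congr 1
  field_simp
  norm_num

theorem J_eq (hp : 1 < p) {u : W012 N Ω} (hu : c₂ p u ≠ ⊤) :
    J p f u = ((‖u‖ ^ 2 / 2 - f u + (c₂ p u).toReal ^ 2 / 2 : ℝ) : EReal) := by
  rw [J, lintegral_rpow_eq_c₂_sq hp, coe_add_coe_half (ENNReal.pow_ne_top hu), ENNReal.toReal_pow]

theorem c₂_smul (hp : 1 < p) (t : ℝ) (u : W012 N Ω) : c₂ p (t • u) = ‖t‖ₑ * c₂ p u := by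
  have hq : 0 ≤ 2 * p / (p + 1) := by positivity
  have h : ∫⁻ x in Ω, ‖(t • u : W012 N Ω) x‖ₑ ^ (2 * p / (p + 1)) =
      ‖t‖ₑ ^ (2 * p / (p + 1)) * ∫⁻ x in Ω, ‖u x‖ₑ ^ (2 * p / (p + 1)) := by
    rw [← lintegral_const_mul' _ _ (ENNReal.rpow_ne_top_of_nonneg hq enorm_ne_top)]
    refine lintegral_congr_ae ?_
    filter_upwards [W012.coeFn_smul t u] with x hx
    rw [hx, enorm_mul, ENNReal.mul_rpow_of_nonneg _ _ hq]
  rw [c₂, h, ENNReal.mul_rpow_of_nonneg _ _ (by positivity), ← ENNReal.rpow_mul,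
    show 2 * p / (p + 1) * ((p + 1) / (2 * p)) = 1 by field_simp, ENNReal.rpow_one, c₂]

theorem c₂_ne_top_of_isTestFunction (hp : 1 < p) {v : W012 N Ω}
    {φ : EuclideanSpace ℝ (Fin N) → ℝ} (hφ : IsTestFunction Ω φ) (h : v =ᵐ[volume] φ) :
    c₂ p v ≠ ⊤ := by
  have hq : 0 < 2 * p / (p + 1) := by positivity
  refine ENNReal.rpow_ne_top_of_nonneg (by positivity) ?_
  have hm : MemLp φ (ENNReal.ofReal (2 * p / (p + 1))) (volume.restrict Ω) :=
    (hφ.smooth.continuous.memLp_of_hasCompactSupport hφ.compact).restrict Ω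
  have := (lintegral_rpow_enorm_lt_top_of_eLpNorm_lt_top (by simpa using hq)
    ENNReal.ofReal_ne_top hm.2).ne
  rw [ENNReal.toReal_ofReal hq.le] at this
  refine ne_of_eq_of_ne (lintegral_congr_ae ?_) this
  filter_upwards [ae_restrict_of_ae h] with x hx
  rw [hx]

/-- Otherwise `u₀ = 0` and the minimum of `J` is `0`, whereas a small multiple of a test function
`v` with `f v ≠ 0` has negative value. -/
theorem IsOptimalFunction.c₂_pos (hp : 1 < p) (hΩ : IsOpen Ω) (hf : f ≠ 0) {u₀ : W012 N Ω}
    (h : IsOptimalFunction p f u₀) : 0 < (c₂ p u₀).toReal := by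
  refine ENNReal.toReal_pos (fun h0 => ?_) (h.c₂_ne_top hp)
  have hu : u₀ = 0 := by
    refine W012.eq_zero_of_ae_restrict hΩ ?_
    have hq : 0 < 2 * p / (p + 1) := by positivity
    have h1 := lintegral_eq_c₂_rpow hp u₀
    rw [h0, ENNReal.zero_rpow_of_pos hq,
      lintegral_eq_zero_iff' ((W012.aemeasurable u₀).enorm.pow_const _)] at h1
    filter_upwards [h1] with x hx
    simpa [ENNReal.rpow_eq_zero_iff, hq, hq.le] using hx
  obtain ⟨v, φ, hφ, hv, hfv⟩ := W012.exists_isTestFunction_of_ne_zero hf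
  have hvt := c₂_ne_top_of_isTestFunction hp hφ hv
  obtain ⟨K, hK⟩ : ∃ K, K = ‖v‖ ^ 2 + (c₂ p v).toReal ^ 2 := ⟨_, rfl⟩
  have hK0 : 0 ≤ K := hK ▸ by positivity
  -- Near the minimiser `f v / K` of `t ↦ K t²/2 - t f v`; `K + 1` keeps the denominator positive.
  have hmin := h ((f v / (K + 1)) • v)
  rw [hu, J_zero hp, J_eq hp (by rw [c₂_smul hp]; exact ENNReal.mul_ne_top enorm_ne_top hvt),
    c₂_smul hp, ← EReal.coe_zero, EReal.coe_le_coe_iff, norm_smul, map_smul, ENNReal.toReal_mul,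
    toReal_enorm, mul_pow, mul_pow, Real.norm_eq_abs, sq_abs, smul_eq_mul] at hmin
  have e : (f v / (K + 1)) ^ 2 * ‖v‖ ^ 2 / 2 - f v / (K + 1) * f v +
      (f v / (K + 1)) ^ 2 * (c₂ p v).toReal ^ 2 / 2 = -((f v) ^ 2 * ((K + 2) / (2 * (K + 1) ^ 2))) := by
    rw [show ‖v‖ ^ 2 = K - (c₂ p v).toReal ^ 2 by linarith]
    field_simp
    ring
  rw [e] at hmin
  have : 0 < (f v) ^ 2 * ((K + 2) / (2 * (K + 1) ^ 2)) := by positivity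
  linarith

theorem schrodingerFunctional_eq {V : EuclideanSpace ℝ (Fin N) → ℝ≥0∞} {u : W012 N Ω}
    (h : ∫⁻ x in Ω, V x * ENNReal.ofReal (u x ^ 2) ≠ ⊤) :
    schrodingerFunctional f V u = ((‖u‖ ^ 2 / 2 - f u +
      (∫⁻ x in Ω, V x * ENNReal.ofReal (u x ^ 2)).toReal / 2 : ℝ) : EReal) := by
  rw [schrodingerFunctional, coe_add_coe_half h]

/-- The potential `c₂^{2/(p+1)} |u|^{-2/(p+1)}`. -/
noncomputable def powerPotential (p : ℝ) (u : W012 N Ω) : EuclideanSpace ℝ (Fin N) → ℝ≥0∞ :=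
  fun x => (ENNReal.ofReal ((|u x| / (c₂ p u).toReal) ^ (2 / (p + 1))))⁻¹

theorem aemeasurable_powerPotential (u : W012 N Ω) :
    AEMeasurable (powerPotential p u) (volume.restrict Ω) := by
  have := u.aemeasurable
  unfold powerPotential
  simp only [← Real.norm_eq_abs]
  fun_prop

theorem lintegral_powerPotential_rpow_neg (hp : 1 < p) {u : W012 N Ω}
    (h0 : 0 < (c₂ p u).toReal) : ∫⁻ x in Ω, powerPotential p u x ^ (-p) = 1 := by
  have ht : c₂ p u ≠ ⊤ := fun h => by simp [h] at h0
  have hq : 0 ≤ 2 * p / (p + 1) := by positivity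
  have h1 : ∀ x, powerPotential p u x ^ (-p) =
      (c₂ p u ^ (2 * p / (p + 1)))⁻¹ * ‖u x‖ₑ ^ (2 * p / (p + 1)) := by
    intro x
    rw [powerPotential, ENNReal.inv_rpow, ENNReal.rpow_neg, inv_inv,
      ENNReal.ofReal_rpow_of_nonneg (by positivity) (by linarith), ← Real.rpow_mul (by positivity),
      show 2 / (p + 1) * p = 2 * p / (p + 1) by ring, ← ENNReal.ofReal_rpow_of_nonneg
      (by positivity) hq, ENNReal.ofReal_div_of_pos h0, ENNReal.ofReal_toReal ht,
      ENNReal.div_rpow_of_nonneg _ _ hq, Real.enorm_eq_ofReal_abs, ENNReal.div_eq_inv_mul]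
  have h2 : c₂ p u ^ (2 * p / (p + 1)) ≠ 0 := by
    have := ENNReal.toReal_pos_iff.1 h0
    simp [ENNReal.rpow_eq_zero_iff, this.1.ne', ht]
  simp only [h1]
  rw [lintegral_const_mul' _ _ (ENNReal.inv_ne_top.2 h2), lintegral_eq_c₂_rpow hp,
    ENNReal.inv_mul_cancel h2 (ENNReal.rpow_ne_top_of_nonneg hq ht)]

theorem isAdmissible_powerPotential (hp : 1 < p) {u : W012 N Ω} (h0 : 0 < (c₂ p u).toReal) :
    IsAdmissible Ω p (powerPotential p u) :=
  ⟨aemeasurable_powerPotential u, (lintegral_powerPotential_rpow_neg hp h0).le⟩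

theorem lintegral_powerPotential_mul_sq (hp : 1 < p) {u : W012 N Ω}
    (h0 : 0 < (c₂ p u).toReal) :
    ∫⁻ x in Ω, powerPotential p u x * ENNReal.ofReal (u x ^ 2) =
      ENNReal.ofReal ((c₂ p u).toReal ^ 2) := by
  obtain ⟨a, ha⟩ : ∃ a, a = (c₂ p u).toReal := ⟨_, rfl⟩
  rw [← ha] at h0 ⊢
  have ht : c₂ p u ≠ ⊤ := fun h => by simp [ha, h] at h0
  have hq : 0 < 2 * p / (p + 1) := by positivity
  have h1 : ∀ x, powerPotential p u x * ENNReal.ofReal (u x ^ 2) =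
      ENNReal.ofReal (a ^ (2 / (p + 1))) * ‖u x‖ₑ ^ (2 * p / (p + 1)) := by
    intro x
    rcases eq_or_ne (u x) 0 with h | h
    · simp [h, ENNReal.zero_rpow_of_pos hq]
    have hx : 0 < |u x| := abs_pos.2 h
    rw [powerPotential, ← ha, ← ENNReal.ofReal_inv_of_pos (by positivity), Real.enorm_eq_ofReal_abs,
      ENNReal.ofReal_rpow_of_nonneg hx.le hq.le, ← ENNReal.ofReal_mul (by positivity),
      ← ENNReal.ofReal_mul (by positivity), Real.div_rpow hx.le h0.le, inv_div, ← sq_abs,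
      ← Real.rpow_natCast, div_mul_eq_mul_div, mul_div_assoc, ← Real.rpow_sub hx]
    congr 3
    push_cast
    field_simp
    ring
  simp only [h1]
  rw [lintegral_const_mul' _ _ ENNReal.ofReal_ne_top, lintegral_eq_c₂_rpow hp,
    ← ENNReal.ofReal_toReal ht, ← ha, ENNReal.ofReal_rpow_of_nonneg h0.le hq.le,
    ← ENNReal.ofReal_mul (by positivity), ← Real.rpow_add h0, ← Real.rpow_natCast]
  congr 2
  push_cast
  field_simp
  ring

/-- The equality case of Hölder, which links the minimisation over potentials to that of `J`. -/
theorem schrodingerFunctional_powerPotential (hp : 1 < p) {u : W012 N Ω}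
    (h0 : 0 < (c₂ p u).toReal) :
    schrodingerFunctional f (powerPotential p u) u =
      ((‖u‖ ^ 2 / 2 - f u + (c₂ p u).toReal ^ 2 / 2 : ℝ) : EReal) := by
  have h := lintegral_powerPotential_mul_sq hp h0
  rw [schrodingerFunctional_eq (h ▸ ENNReal.ofReal_ne_top), h,
    ENNReal.toReal_ofReal (by positivity)]

/-- The energy gap obtained by testing the minimality of `u₀` with the midpoint of `u`, `u₀`. -/
theorem IsOptimalFunction.energy_gap (hp : 1 < p) {u₀ : W012 N Ω} (h : IsOptimalFunction p f u₀)
    (h0 : 0 < (c₂ p u₀).toReal) {V : EuclideanSpace ℝ (Fin N) → ℝ≥0∞} (hV : IsAdmissible Ω p V)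
    {u : W012 N Ω} (hVu : ∫⁻ x in Ω, V x * ENNReal.ofReal (u x ^ 2) ≠ ⊤)
    (hW : ∫⁻ x in Ω, harmonicMean V (powerPotential p u₀) x ^ (-p) ≤ 1) :
    c₂ p ((1 / 2 : ℝ) • (u + u₀)) ≠ ⊤ ∧
    (1 - (∫⁻ x in Ω, harmonicMean V (powerPotential p u₀) x ^ (-p)).toReal ^ (1 / p)) *
      (c₂ p ((1 / 2 : ℝ) • (u + u₀))).toReal ^ 2 + ‖u - u₀‖ ^ 2 / 4 ≤
    (‖u‖ ^ 2 / 2 - f u + (∫⁻ x in Ω, V x * ENNReal.ofReal (u x ^ 2)).toReal / 2) -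
      (‖u₀‖ ^ 2 / 2 - f u₀ + (c₂ p u₀).toReal ^ 2 / 2) := by
  obtain ⟨m, hm⟩ : ∃ m, m = (1 / 2 : ℝ) • (u + u₀) := ⟨_, rfl⟩
  obtain ⟨W, hWd⟩ : ∃ W, W = harmonicMean V (powerPotential p u₀) := ⟨_, rfl⟩
  obtain ⟨a, ha⟩ : ∃ a, a = (c₂ p u₀).toReal := ⟨_, rfl⟩
  have hi := lintegral_powerPotential_mul_sq hp h0
  rw [← hm, ← hWd, ← ha]
  rw [← hWd] at hW
  rw [← ha] at hi h0
  have hmx : ∀ᵐ x ∂volume.restrict Ω, m x = (u x + u₀ x) / 2 := by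
    filter_upwards [W012.coeFn_smul (1 / 2 : ℝ) (u + u₀), W012.coeFn_add u u₀] with x h1 h2
    rw [hm, h1, h2]; ring
  have hP := aemeasurable_powerPotential (p := p) u₀
  have hWm : AEMeasurable W (volume.restrict Ω) := by
    have := hV.measurable
    rw [hWd]; unfold harmonicMean; fun_prop
  have hMle : ∫⁻ x in Ω, W x * ENNReal.ofReal (m x ^ 2) ≤
      ((∫⁻ x in Ω, V x * ENNReal.ofReal (u x ^ 2)) + ENNReal.ofReal (a ^ 2)) / 2 := by
    have hVm : AEMeasurable (fun x => V x * ENNReal.ofReal (u x ^ 2)) (volume.restrict Ω) :=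
      hV.measurable.mul (u.aemeasurable.pow_const 2).ennreal_ofReal
    rw [← hi, ← lintegral_add_left' hVm, div_eq_mul_inv, ← lintegral_mul_const' _ _ (by simp)]
    refine lintegral_mono_ae ?_
    filter_upwards [hmx] with x hx
    rw [hx, hWd, ← div_eq_mul_inv]
    exact harmonicMean_mul_sq_le _ _ _ _ _
  have hMt : ∫⁻ x in Ω, W x * ENNReal.ofReal (m x ^ 2) ≠ ⊤ :=
    ne_top_of_le_ne_top (ENNReal.div_ne_top (ENNReal.add_ne_top.2 ⟨hVu, ENNReal.ofReal_ne_top⟩)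
      (by simp)) hMle
  have hH := lintegral_enorm_rpow_le hp hWm m.aemeasurable (ne_top_of_le_ne_top (by simp) hW) hMt
  rw [lintegral_rpow_eq_c₂_sq hp] at hH
  have hLt : (∫⁻ x in Ω, W x ^ (-p)) ^ (1 / p) ≤ 1 := ENNReal.rpow_le_one hW (by positivity)
  have hct : c₂ p m ≠ ⊤ := by
    intro hc
    rw [hc] at hH
    exact ENNReal.mul_ne_top (ne_top_of_le_ne_top (by simp) hLt) hMt (top_le_iff.1 (by simpa using hH))
  refine ⟨hct, ?_⟩
  have hmin := h m
  rw [J_eq hp (h.c₂_ne_top hp), J_eq hp hct, EReal.coe_le_coe_iff, ← ha] at hmin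
  have hH' := ENNReal.toReal_mono (ENNReal.mul_ne_top (ne_top_of_le_ne_top (by simp) hLt) hMt) hH
  rw [ENNReal.toReal_mul, ENNReal.toReal_pow, ← ENNReal.toReal_rpow] at hH'
  have hM' := ENNReal.toReal_mono (ENNReal.div_ne_top (ENNReal.add_ne_top.2
    ⟨hVu, ENNReal.ofReal_ne_top⟩) (by simp)) hMle
  rw [ENNReal.toReal_div, ENNReal.toReal_add hVu ENNReal.ofReal_ne_top,
    ENNReal.toReal_ofReal (by positivity), ENNReal.toReal_ofNat] at hM'
  have hL' : (∫⁻ x in Ω, W x ^ (-p)).toReal ^ (1 / p) ≤ 1 := by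
    rw [ENNReal.toReal_rpow]
    exact ENNReal.toReal_le_of_le_ofReal zero_le_one (by simpa using hLt)
  have hL0 : 0 ≤ (∫⁻ x in Ω, W x ^ (-p)).toReal ^ (1 / p) := by positivity
  have hM0 : 0 ≤ (∫⁻ x in Ω, W x * ENNReal.ofReal (m x ^ 2)).toReal := by positivity
  have hpar := W012.parallelogram u u₀
  have hnm : ‖m‖ ^ 2 = ‖u + u₀‖ ^ 2 / 4 := by
    rw [hm, norm_smul, mul_pow]; norm_num; ring
  have hfm : f m = (f u + f u₀) / 2 := by
    rw [hm, map_smul, map_add, smul_eq_mul]; ring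
  generalize (∫⁻ x in Ω, W x ^ (-p)).toReal ^ (1 / p) = L at *
  generalize (∫⁻ x in Ω, W x * ENNReal.ofReal (m x ^ 2)).toReal = M at *
  generalize (c₂ p m).toReal ^ 2 = Q at *
  -- Here `Q` is the square of `c₂ p m`. From `Q ≤ L M` and `L ≤ 1` one gets `Q ≤ M - (1 - L) Q`;
  -- inserting this in the minimality inequality and doubling gives the gap.
  have hQM : Q ≤ M := hH'.trans (by nlinarith)
  have h1 : (1 - L) * Q ≤ (1 - L) * M := mul_le_mul_of_nonneg_left hQM (by linarith)
  linarith

end Functionals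

/-! ### The distance between inverse potentials. -/

section Potentials

variable {N : ℕ} {Ω : Set (EuclideanSpace ℝ (Fin N))} {p : ℝ}

theorem invDist_rpow_eq (hp : 1 < p) (V U : EuclideanSpace ℝ (Fin N) → ℝ≥0∞) :
    invDist Ω p V U ^ (2 * p) = (∫⁻ x in Ω,
      ENNReal.ofReal (|((V x)⁻¹).toReal - ((U x)⁻¹).toReal| ^ p)).toReal ^ 2 := by
  have hp0 : 0 < p := by linarith
  rw [invDist, eLpNorm_eq_lintegral_rpow_enorm_toReal (by simpa using hp0) ENNReal.ofReal_ne_top,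
    ENNReal.toReal_ofReal hp0.le, ← ENNReal.toReal_rpow, ← Real.rpow_mul (by positivity),
    show 1 / p * (2 * p) = (2 : ℕ) by field_simp; norm_num, Real.rpow_natCast]
  simp only [Real.enorm_eq_ofReal_abs, ENNReal.ofReal_rpow_of_nonneg (abs_nonneg _) hp0.le]

/-- Integrability of `V^{-p}` forces `V > 0` almost everywhere, so passing to real inverses loses
nothing. -/
theorem IsAdmissible.ofReal_inv_rpow (hp : 1 < p) {V : EuclideanSpace ℝ (Fin N) → ℝ≥0∞}
    (hV : IsAdmissible Ω p V) : ∀ᵐ x ∂volume.restrict Ω, (V x)⁻¹ ≠ ⊤ ∧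
      ENNReal.ofReal (((V x)⁻¹).toReal ^ p) = V x ^ (-p) := by
  have hp0 : 0 < p := by linarith
  filter_upwards [ae_lt_top' (hV.measurable.pow_const (-p))
    (ne_top_of_le_ne_top (by simp) hV.integral_le)] with x hx
  have hi : (V x)⁻¹ ≠ ⊤ := by
    intro h
    rw [ENNReal.inv_eq_top] at h
    rw [h, ENNReal.zero_rpow_of_neg (by linarith)] at hx
    exact lt_irrefl _ hx
  refine ⟨hi, ?_⟩
  rw [← ENNReal.ofReal_rpow_of_nonneg ENNReal.toReal_nonneg hp0.le, ENNReal.ofReal_toReal hi,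
    ENNReal.inv_rpow, ENNReal.rpow_neg]

/-- Uniform convexity of `L^p` in terms of potentials. -/
theorem lintegral_harmonicMean_add_le (hp : 1 < p) {V U : EuclideanSpace ℝ (Fin N) → ℝ≥0∞}
    (hV : IsAdmissible Ω p V) (hU : IsAdmissible Ω p U) :
    ∫⁻ x in Ω, harmonicMean V U x ^ (-p) ≤ 1 ∧
      (∫⁻ x in Ω, harmonicMean V U x ^ (-p)).toReal +
        p * (p - 1) / 4 / (2 ^ p) ^ 2 * invDist Ω p V U ^ (2 * p) ≤ 1 := by
  have hp0 : 0 < p := by linarith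
  have hκ : 0 < p * (p - 1) / 4 / (2 ^ p) ^ 2 := by
    have : 0 < p * (p - 1) := mul_pos (by linarith) (by linarith)
    positivity
  have hmean : ∫⁻ x in Ω, harmonicMean V U x ^ (-p) = ∫⁻ x in Ω,
      ENNReal.ofReal (((((V x)⁻¹).toReal + ((U x)⁻¹).toReal) / 2) ^ p) := by
    refine lintegral_congr_ae ?_
    filter_upwards [hV.ofReal_inv_rpow hp, hU.ofReal_inv_rpow hp] with x h1 h2
    rw [← ENNReal.ofReal_rpow_of_nonneg (by positivity) hp0.le, ENNReal.ofReal_div_of_pos two_pos,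
      ENNReal.ofReal_add (by positivity) (by positivity), ENNReal.ofReal_toReal h1.1,
      ENNReal.ofReal_toReal h2.1, harmonicMean, ENNReal.inv_rpow, ENNReal.rpow_neg, inv_inv,
      ENNReal.ofReal_ofNat]
  have hVi : ∫⁻ x in Ω, ENNReal.ofReal (((V x)⁻¹).toReal ^ p) ≤ 1 := by
    refine le_trans (lintegral_congr_ae ?_).le hV.integral_le
    filter_upwards [hV.ofReal_inv_rpow hp] with x hx using hx.2
  have hUi : ∫⁻ x in Ω, ENNReal.ofReal (((U x)⁻¹).toReal ^ p) ≤ 1 := by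
    refine le_trans (lintegral_congr_ae ?_).le hU.integral_le
    filter_upwards [hU.ofReal_inv_rpow hp] with x hx using hx.2
  have key := lintegral_half_add_rpow_add_le hp hV.measurable.inv.ennreal_toReal
    hU.measurable.inv.ennreal_toReal (fun _ => ENNReal.toReal_nonneg)
    (fun _ => ENNReal.toReal_nonneg) hVi hUi
  simp only [Pi.inv_apply] at key
  rw [← hmean] at key
  refine ⟨le_self_add.trans key, ?_⟩
  have h1 := ne_top_of_le_ne_top ENNReal.one_ne_top (le_self_add.trans key)
  have h2 := ne_top_of_le_ne_top ENNReal.one_ne_top (le_add_self.trans key)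
  have := ENNReal.toReal_mono ENNReal.one_ne_top key
  rwa [ENNReal.toReal_add h1 h2, ENNReal.toReal_mul, ENNReal.toReal_ofReal hκ.le,
    ENNReal.toReal_pow, ENNReal.toReal_one, ← invDist_rpow_eq hp] at this

theorem IsAdmissible.memLp_inv (hp : 1 < p) {V : EuclideanSpace ℝ (Fin N) → ℝ≥0∞}
    (hV : IsAdmissible Ω p V) :
    MemLp (fun x => ((V x)⁻¹).toReal) (ENNReal.ofReal p) (volume.restrict Ω) := by
  have hp0 : 0 < p := by linarith
  refine ⟨hV.measurable.inv.ennreal_toReal.aestronglyMeasurable, ?_⟩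
  rw [eLpNorm_lt_top_iff_lintegral_rpow_enorm_lt_top (by simpa using hp0) ENNReal.ofReal_ne_top,
    ENNReal.toReal_ofReal hp0.le]
  refine lt_of_le_of_lt (le_trans (lintegral_congr_ae ?_).le hV.integral_le) ENNReal.one_lt_top
  filter_upwards [hV.ofReal_inv_rpow hp] with x hx
  rw [← hx.2, Real.enorm_of_nonneg ENNReal.toReal_nonneg,
    ENNReal.ofReal_rpow_of_nonneg ENNReal.toReal_nonneg hp0.le]

theorem ae_eq_of_invDist_eq_zero (hp : 1 < p) {V U : EuclideanSpace ℝ (Fin N) → ℝ≥0∞}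
    (hV : IsAdmissible Ω p V) (hU : IsAdmissible Ω p U) (h : invDist Ω p V U = 0) :
    (fun x => ((V x)⁻¹).toReal) =ᵐ[volume.restrict Ω] fun x => ((U x)⁻¹).toReal := by
  have hm := (hV.memLp_inv hp).sub (hU.memLp_inv hp)
  have h0 := ((ENNReal.toReal_eq_zero_iff _).1 h).resolve_right hm.2.ne
  filter_upwards [(eLpNorm_eq_zero_iff hm.1 (by simpa using by linarith)).1 h0] with x hx
  exact sub_eq_zero.1 hx

end Potentials

/-! ### The stability estimate and identification of the optimal potential. -/

section Stability

variable {N : ℕ} [Fact (3 ≤ N)] {Ω : Set (EuclideanSpace ℝ (Fin N))} {p : ℝ}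
  {f : StrongDual ℝ (W012 N Ω)}

/-- Split `|u|^{2p/(p+1)} = |u|^{(p-1)/(p+1)} |u|` and use `|u| ≤ |m| + |u - m|`, with Hölder for
the exponents `2p/(p-1)`, `2p/(p+1)` and then `(2^*)'`, `2^*`. This keeps `c₂ p m` away from zero
when `m` is close to `u` in `L^{2^*}`, and is where `c₄` enters. -/
theorem c₂_rpow_le (hp : 1 < p) (u m : W012 N Ω) :
    c₂ p u ^ (2 * p / (p + 1)) ≤ c₂ p u ^ ((p - 1) / (p + 1)) * c₂ p m +
      c₄ p u * ‖W012.toLp (u - m)‖ₑ := by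
  have hp0 : 0 < p := by linarith
  have hp1 : 0 < p - 1 := by linarith
  have hα : 0 < (p - 1) / (p + 1) := by positivity
  have hq : 2 * p / (p + 1) = (p - 1) / (p + 1) + 1 := by field_simp; ring
  have hsub : ∀ᵐ x ∂volume.restrict Ω, W012.toLp (u - m) x = u x - m x := by
    refine ae_restrict_of_ae ?_
    filter_upwards [Lp.coeFn_sub (W012.toLp u) (W012.toLp m)] with x hx
    rw [map_sub, hx]; rfl
  have hum : AEMeasurable (fun x => ‖u x‖ₑ) (volume.restrict Ω) := u.aemeasurable.enorm
  have hmm : AEMeasurable (fun x => ‖m x‖ₑ) (volume.restrict Ω) := m.aemeasurable.enorm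
  have h1 : ∫⁻ x in Ω, ‖u x‖ₑ ^ ((p - 1) / (p + 1)) * ‖m x‖ₑ ≤
      c₂ p u ^ ((p - 1) / (p + 1)) * c₂ p m := by
    have := ENNReal.lintegral_mul_norm_pow_le (hum.pow_const (2 * p / (p + 1)))
      (hmm.pow_const (2 * p / (p + 1))) (p := (p - 1) / (2 * p)) (q := (p + 1) / (2 * p))
      (by positivity) (by positivity) (by field_simp; ring)
    simp only [← ENNReal.rpow_mul, show 2 * p / (p + 1) * ((p + 1) / (2 * p)) = 1 by field_simp,
      ENNReal.rpow_one] at this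
    rw [show 2 * p / (p + 1) * ((p - 1) / (2 * p)) = (p - 1) / (p + 1) by field_simp] at this
    refine this.trans_eq ?_
    rw [c₂, c₂, ← ENNReal.rpow_mul]
    congr 2
    field_simp
  have h2 : ∫⁻ x in Ω, ‖u x‖ₑ ^ ((p - 1) / (p + 1)) * ‖W012.toLp (u - m) x‖ₑ ≤
      c₄ p u * ‖W012.toLp (u - m)‖ₑ := by
    have := eLpNorm_smul_le_mul_eLpNorm (μ := volume.restrict Ω)
      (φ := fun x => |u x| ^ ((p - 1) / (p + 1))) (f := W012.toLp (u - m))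
      (p := ENNReal.ofReal (twoStar N).conjExponent) (q := ENNReal.ofReal (twoStar N)) (r := 1)
      (u - m).aemeasurable.aestronglyMeasurable
      (by simp only [← Real.norm_eq_abs]
          exact (u.aemeasurable.norm.pow_const _).aestronglyMeasurable)
    rw [eLpNorm_one_eq_lintegral_enorm] at this
    refine le_trans (lintegral_mono fun x => ?_) (this.trans ?_)
    · rw [Pi.smul_apply', smul_eq_mul, enorm_mul, Real.enorm_eq_ofReal_abs (u x),
        Real.enorm_of_nonneg (Real.rpow_nonneg (abs_nonneg _) _),
        ENNReal.ofReal_rpow_of_nonneg (abs_nonneg _) hα.le]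
    · rw [c₄, Lp.enorm_def]
      gcongr
      exact Measure.restrict_le_self
  calc c₂ p u ^ (2 * p / (p + 1)) = ∫⁻ x in Ω, ‖u x‖ₑ ^ (2 * p / (p + 1)) :=
        (lintegral_eq_c₂_rpow hp u).symm
    _ ≤ ∫⁻ x in Ω, (‖u x‖ₑ ^ ((p - 1) / (p + 1)) * ‖m x‖ₑ +
          ‖u x‖ₑ ^ ((p - 1) / (p + 1)) * ‖W012.toLp (u - m) x‖ₑ) := by
        refine lintegral_mono_ae ?_
        filter_upwards [hsub] with x hx
        rw [hx, hq, ENNReal.rpow_add_of_nonneg _ _ hα.le zero_le_one, ENNReal.rpow_one, ← mul_add]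
        gcongr
        calc ‖u x‖ₑ = ‖m x + (u x - m x)‖ₑ := by rw [add_sub_cancel]
          _ ≤ _ := enorm_add_le _ _
    _ ≤ _ := by
        have hprod : AEMeasurable (fun x => ‖u x‖ₑ ^ ((p - 1) / (p + 1)) * ‖m x‖ₑ)
            (volume.restrict Ω) := (hum.pow_const _).mul hmm
        rw [lintegral_add_left' hprod]
        exact add_le_add h1 h2

/-- The stability constant, for given `c₂ = a`, `c₄ = b` and Sobolev constant `C`. -/
noncomputable def stabilityConst (p C a b : ℝ) : ℝ :=
  min (a ^ 2 / (4 * p)) ((a ^ (2 * p / (p + 1)) / (2 * C * (b + 1))) ^ 2) *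
    (p * (p - 1) / 4 / (2 ^ p) ^ 2) *
    (p * (p - 1) / 4 / (2 ^ p) ^ 2) ^ (((p + 1) / (p - 1)) - 1)

theorem stabilityConst_pos {C a b : ℝ} (hp : 1 < p) (hC : 0 < C) (ha : 0 < a) (hb : 0 ≤ b) :
    0 < stabilityConst p C a b := by
  have : 0 < p * (p - 1) := mul_pos (by linarith) (by linarith)
  have hp0 : 0 < p := by linarith
  unfold stabilityConst
  have : 0 < min (a ^ 2 / (4 * p)) ((a ^ (2 * p / (p + 1)) / (2 * C * (b + 1))) ^ 2) :=
    lt_min (by positivity) (by positivity)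
  positivity

theorem IsOptimalFunction.add_stabilityConst_le (hp : 1 < p) {u₀ : W012 N Ω}
    (h : IsOptimalFunction p f u₀) (h0 : 0 < (c₂ p u₀).toReal) (h4 : c₄ p u₀ ≠ ⊤) {C : ℝ}
    (hC : 0 < C) (hS : ∀ u : W012 N Ω, ‖W012.toLp u‖ ≤ C * ‖u‖)
    {V : EuclideanSpace ℝ (Fin N) → ℝ≥0∞} (hV : IsAdmissible Ω p V) (u : W012 N Ω) :
    ((‖u₀‖ ^ 2 / 2 - f u₀ + (c₂ p u₀).toReal ^ 2 / 2 +
      stabilityConst p C (c₂ p u₀).toReal (c₄ p u₀).toReal *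
        invDist Ω p V (powerPotential p u₀) ^ (2 * p * (p + 1) / (p - 1)) : ℝ) : EReal) ≤
      schrodingerFunctional f V u := by
  rcases eq_or_ne (∫⁻ x in Ω, V x * ENNReal.ofReal (u x ^ 2)) ⊤ with hVu | hVu
  · rw [schrodingerFunctional, hVu, coe_add_coe_top_half]
    exact le_top
  rw [schrodingerFunctional_eq hVu, EReal.coe_le_coe_iff, ← le_sub_iff_add_le']
  obtain ⟨hW, hconv⟩ := lintegral_harmonicMean_add_le hp hV (isAdmissible_powerPotential hp h0)
  obtain ⟨hct, hgap⟩ := h.energy_gap hp h0 hV hVu hW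
  have hlow := c₂_rpow_le hp u₀ ((1 / 2 : ℝ) • (u + u₀))
  have hdiff : u₀ - (1 / 2 : ℝ) • (u + u₀) = (-(1 / 2) : ℝ) • (u - u₀) := by module
  have hut := h.c₂_ne_top hp
  have hp0 : 0 < p := by linarith
  have hp1 : 0 < p - 1 := by linarith
  have hα : 0 < (p - 1) / (p + 1) := by positivity
  rw [hdiff, map_smul] at hlow
  have hlow' := ENNReal.toReal_mono (ENNReal.add_ne_top.2
    ⟨ENNReal.mul_ne_top (ENNReal.rpow_ne_top_of_nonneg hα.le hut) hct,
      ENNReal.mul_ne_top h4 enorm_ne_top⟩) hlow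
  rw [ENNReal.toReal_add (ENNReal.mul_ne_top (ENNReal.rpow_ne_top_of_nonneg hα.le hut) hct)
    (ENNReal.mul_ne_top h4 enorm_ne_top), ENNReal.toReal_mul, ENNReal.toReal_mul,
    ← ENNReal.toReal_rpow, ← ENNReal.toReal_rpow, toReal_enorm, norm_smul] at hlow'
  have hSu := hS (u - u₀)
  have hb0 : 0 ≤ (c₄ p u₀).toReal := ENNReal.toReal_nonneg
  have hQ0 : 0 ≤ (c₂ p ((1 / 2 : ℝ) • (u + u₀))).toReal := ENNReal.toReal_nonneg
  have hD0 : 0 ≤ invDist Ω p V (powerPotential p u₀) := ENNReal.toReal_nonneg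
  have hL0 : 0 ≤ (∫⁻ x in Ω, harmonicMean V (powerPotential p u₀) x ^ (-p)).toReal :=
    ENNReal.toReal_nonneg
  have hn0 := norm_nonneg (u - u₀)
  refine le_trans ?_ hgap
  generalize (c₂ p ((1 / 2 : ℝ) • (u + u₀))).toReal = Q at *
  generalize (∫⁻ x in Ω, harmonicMean V (powerPotential p u₀) x ^ (-p)).toReal = L at *
  generalize invDist Ω p V (powerPotential p u₀) = D at *
  generalize (c₄ p u₀).toReal = b at *
  generalize (c₂ p u₀).toReal = a at *
  generalize ‖u - u₀‖ = n at *
  generalize ‖W012.toLp (u - u₀)‖ = s at *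
  clear hgap hlow hct hut hW hVu hdiff h4
  unfold stabilityConst
  obtain ⟨κ, hκ⟩ : ∃ κ, κ = p * (p - 1) / 4 / (2 ^ p) ^ 2 := ⟨_, rfl⟩
  have hκ0 : 0 < κ := by
    have : 0 < p * (p - 1) := mul_pos (by linarith) (by linarith)
    rw [hκ]; positivity
  rw [← hκ] at hconv ⊢
  have hDp : 0 ≤ D ^ (2 * p) := Real.rpow_nonneg hD0 _
  have hκD : κ * D ^ (2 * p) ≤ 1 := by linarith
  -- lowering the exponent
  have hexp : κ ^ ((p + 1) / (p - 1) - 1) * D ^ (2 * p * (p + 1) / (p - 1)) ≤ D ^ (2 * p) := by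
    have he : 0 ≤ (p + 1) / (p - 1) - 1 := by
      rw [sub_nonneg, le_div_iff₀ hp1]; linarith
    have : D ^ (2 * p * (p + 1) / (p - 1)) =
        (D ^ (2 * p)) ^ ((p + 1) / (p - 1) - 1) * D ^ (2 * p) := by
      rw [← Real.rpow_mul hD0, ← Real.rpow_add_of_nonneg hD0 (by positivity) (by positivity)]
      congr 1; ring
    rw [this, ← mul_assoc, ← Real.mul_rpow hκ0.le hDp]
    exact mul_le_of_le_one_left hDp (Real.rpow_le_one (by positivity) hκD he)
  -- Bernoulli
  have hlam : κ * D ^ (2 * p) / p ≤ 1 - L ^ (1 / p) := by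
    have h1 := one_add_mul_self_le_rpow_one_add (s := L ^ (1 / p) - 1)
      (by linarith [Real.rpow_nonneg hL0 (1 / p)]) hp.le
    rw [add_sub_cancel, ← Real.rpow_mul hL0, one_div_mul_cancel hp0.ne', Real.rpow_one] at h1
    rw [div_le_iff₀ hp0]
    linarith
  have hlam0 : 0 ≤ 1 - L ^ (1 / p) := le_trans (by positivity) hlam
  -- The radius `e` makes the `c₄` error term at most half of `a^{2p/(p+1)}`; `b + 1` avoids
  -- dividing by zero.
  obtain ⟨e, he⟩ : ∃ e, e = a ^ (2 * p / (p + 1)) / (2 * C * (b + 1)) := ⟨_, rfl⟩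
  rw [← he]
  have he0 : 0 < e := by rw [he]; positivity
  have hstep : min (a ^ 2 / (4 * p)) (e ^ 2) * κ * κ ^ ((p + 1) / (p - 1) - 1) *
      D ^ (2 * p * (p + 1) / (p - 1)) ≤ min (a ^ 2 / (4 * p)) (e ^ 2) * (κ * D ^ (2 * p)) := by
    rw [mul_assoc, mul_assoc]
    gcongr
  refine hstep.trans ?_
  -- If `u` is close to `u₀`, then `c₂` of the midpoint is at least `a / 2` and uniform convexity
  -- gives the bound; if it is far, `n² / 4` exceeds `e²` while `κ D^{2p} ≤ 1`.
  rcases le_or_gt (n / 2) e with hn | hn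
  · have hQ : a / 2 ≤ Q := by
      have h1 : b * (‖(-(1 / 2) : ℝ)‖ * s) ≤ a ^ (2 * p / (p + 1)) / 2 := by
        have hnorm : ‖(-(1 / 2) : ℝ)‖ = 1 / 2 := by norm_num
        have : a ^ (2 * p / (p + 1)) / 2 = (b + 1) * (C * e) := by rw [he]; field_simp
        rw [hnorm, this]
        have h2 : 1 / 2 * s ≤ C * e := by nlinarith
        have h3 : 0 ≤ C * e := by positivity
        nlinarith [mul_le_mul_of_nonneg_left h2 hb0]
      have h2 : a ^ (2 * p / (p + 1)) = a ^ ((p - 1) / (p + 1)) * a := by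
        rw [← Real.rpow_add_one h0.ne']
        congr 1; field_simp; ring
      have h3 : a ^ ((p - 1) / (p + 1)) * (a / 2) ≤ a ^ ((p - 1) / (p + 1)) * Q := by linarith
      exact le_of_mul_le_mul_left h3 (Real.rpow_pos_of_pos h0 _)
    calc min (a ^ 2 / (4 * p)) (e ^ 2) * (κ * D ^ (2 * p))
        ≤ a ^ 2 / (4 * p) * (κ * D ^ (2 * p)) := by
          gcongr; exact min_le_left _ _
      _ = κ * D ^ (2 * p) / p * (a / 2) ^ 2 := by field_simp; ring
      _ ≤ (1 - L ^ (1 / p)) * Q ^ 2 := by gcongr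
      _ ≤ _ := by linarith [sq_nonneg n]
  · calc min (a ^ 2 / (4 * p)) (e ^ 2) * (κ * D ^ (2 * p)) ≤ e ^ 2 * 1 := by
          gcongr; exact min_le_right _ _
      _ ≤ (n / 2) ^ 2 := by rw [mul_one]; gcongr
      _ ≤ _ := by nlinarith [mul_nonneg hlam0 (sq_nonneg Q)]

theorem energy_powerPotential_le (hp : 1 < p) {u₀ : W012 N Ω}
    (h0 : 0 < (c₂ p u₀).toReal) : energy f (powerPotential p u₀) ≤
      ((‖u₀‖ ^ 2 / 2 - f u₀ + (c₂ p u₀).toReal ^ 2 / 2 : ℝ) : EReal) :=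
  (iInf_le _ u₀).trans (schrodingerFunctional_powerPotential hp h0).le

/-- Every optimal potential has the inverse `c₂^{-2/(p+1)} |u₀|^{2/(p+1)}`. -/
theorem IsOptimalPotential.inv_ae_eq (hp : 1 < p) {U₀ : EuclideanSpace ℝ (Fin N) → ℝ≥0∞}
    (hU : IsOptimalPotential p f U₀) {u₀ : W012 N Ω} (h : IsOptimalFunction p f u₀)
    (h0 : 0 < (c₂ p u₀).toReal) (h4 : c₄ p u₀ ≠ ⊤) {C : ℝ}
    (hC : 0 < C) (hS : ∀ u : W012 N Ω, ‖W012.toLp u‖ ≤ C * ‖u‖) :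
    (fun x => ((U₀ x)⁻¹).toReal) =ᵐ[volume.restrict Ω]
      fun x => ((powerPotential p u₀ x)⁻¹).toReal := by
  refine ae_eq_of_invDist_eq_zero hp hU.admissible (isAdmissible_powerPotential hp h0) ?_
  -- Apply the estimate to `U₀` itself: optimality caps its energy by `J(u₀)`, leaving no room for a
  -- positive distance.
  have h1 := le_iInf (h.add_stabilityConst_le hp h0 h4 hC hS hU.admissible)
  have h2 := (hU.energy_le _ (isAdmissible_powerPotential hp h0)).trans
    (energy_powerPotential_le hp h0)
  have h3 := h1.trans h2
  rw [EReal.coe_le_coe_iff] at h3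
  have hσ := stabilityConst_pos hp hC h0 (ENNReal.toReal_nonneg (a := c₄ p u₀))
  have hD0 : 0 ≤ invDist Ω p U₀ (powerPotential p u₀) := ENNReal.toReal_nonneg
  by_contra hne
  have := mul_pos hσ (Real.rpow_pos_of_pos (lt_of_le_of_ne hD0 (Ne.symm hne))
    (2 * p * (p + 1) / (p - 1)))
  linarith

/-- The condition `c₄ < ∞` is automatic on domains of finite measure. -/
theorem c₄_lt_top (hp : 1 < p) (hΩ : volume Ω < ⊤) (u : W012 N Ω) : c₄ p u < ⊤ := by
  have : IsFiniteMeasure (volume.restrict Ω) := ⟨by simpa using hΩ⟩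
  have hα : 0 < (p - 1) / (p + 1) := div_pos (by linarith) (by linarith)
  have hα1 : (p - 1) / (p + 1) ≤ 1 := by rw [div_le_one (by linarith)]; linarith
  have hN : (3 : ℝ) ≤ N := by exact_mod_cast (Fact.out : 3 ≤ N)
  -- The exponent of `|u|` in `c₄` is at most `(2^*)' ≤ 2^*`, so on finite measure the `L^{2^*}`
  -- bound is enough.
  have hle : ENNReal.ofReal (twoStar N).conjExponent * ENNReal.ofReal ((p - 1) / (p + 1)) ≤
      ENNReal.ofReal (twoStar N) := by
    have h1 : (twoStar N).conjExponent ≤ twoStar N := by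
      have h2 : 2 ≤ twoStar N := by
        rw [twoStar, le_div_iff₀ (by linarith)]; linarith
      rw [Real.conjExponent, div_le_iff₀ (by linarith)]
      nlinarith
    calc _ ≤ ENNReal.ofReal (twoStar N) * 1 := by
          gcongr; simpa using ENNReal.ofReal_le_ofReal hα1
      _ = _ := mul_one _
  simp only [c₄, ← Real.norm_eq_abs]
  rw [eLpNorm_norm_rpow _ hα]
  exact ENNReal.rpow_lt_top_of_nonneg hα.le
    (((Lp.memLp (W012.toLp u)).restrict Ω).mono_exponent hle).2.ne

end Stability

end SchrodingerStability

/-! ### The main theorem. -/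

theorem theorem6p5 (N : ℕ) [Fact (3 ≤ N)] (p : ℝ) (hp : 1 < p) :
    (∃ σ : ℝ → ℝ → ℝ → ℝ, (∀ a b c : ℝ, 0 < σ a b c) ∧
      ∀ (Ω : Set (EuclideanSpace ℝ (Fin N))), IsOpen Ω →
      ∀ (f : StrongDual ℝ (SchrodingerStability.W012 N Ω)), f ≠ 0 →
      ∀ (U₀ : EuclideanSpace ℝ (Fin N) → ENNReal) (u₀ : SchrodingerStability.W012 N Ω),
        SchrodingerStability.IsOptimalPotential p f U₀ →
        SchrodingerStability.IsOptimalFunction p f u₀ →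
        SchrodingerStability.c₄ p u₀ < ⊤ →
        ∀ V : EuclideanSpace ℝ (Fin N) → ENNReal, SchrodingerStability.IsAdmissible Ω p V →
          ((σ (SchrodingerStability.c₂ p u₀).toReal (SchrodingerStability.c₄ p u₀).toReal ‖f‖ *
              SchrodingerStability.invDist Ω p V U₀ ^ (2 * p * (p + 1) / (p - 1)) : ℝ) : EReal) ≤
            SchrodingerStability.energy f V - SchrodingerStability.energy f U₀) ∧
    (∀ (Ω : Set (EuclideanSpace ℝ (Fin N))), IsOpen Ω →
      MeasureTheory.volume Ω < ⊤ →
      ∀ (f : StrongDual ℝ (SchrodingerStability.W012 N Ω)) (u₀ : SchrodingerStability.W012 N Ω),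
        SchrodingerStability.IsOptimalFunction p f u₀ → SchrodingerStability.c₄ p u₀ < ⊤) := by
  obtain ⟨C, hC, hS⟩ := SchrodingerStability.W012.exists_pos_norm_toLp_le N
  -- The default value `1` only secures positivity at arguments that cannot occur as `c₂` and `c₄`.
  refine ⟨⟨fun a b _ => if 0 < a ∧ 0 ≤ b then SchrodingerStability.stabilityConst p C a b else 1,
    fun a b c => ?_, ?_⟩, fun Ω _ hfin f u₀ _ => SchrodingerStability.c₄_lt_top hp hfin u₀⟩
  · dsimp only
    split_ifs with hab
    · exact SchrodingerStability.stabilityConst_pos hp hC hab.1 hab.2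
    · exact one_pos
  intro Ω hΩ f hf U₀ u₀ hU hu h4 V hV
  have h0 := hu.c₂_pos hp hΩ hf
  have hUe := hU.inv_ae_eq hp hu h0 h4.ne hC (hS Ω)
  have hD : SchrodingerStability.invDist Ω p V U₀ =
      SchrodingerStability.invDist Ω p V (SchrodingerStability.powerPotential p u₀) := by
    unfold SchrodingerStability.invDist
    congr 1
    refine eLpNorm_congr_ae ?_
    filter_upwards [hUe] with x hx
    rw [hx]
  dsimp only
  rw [if_pos ⟨h0, ENNReal.toReal_nonneg⟩, hD]
  -- The energy of `V` is bounded below and that of `U₀` above in terms of the same real number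
  -- `J(u₀)`, which cancels.
  have hlow := le_iInf (hu.add_stabilityConst_le hp h0 h4.ne hC (hS Ω) hV)
  have hup := (hU.energy_le _ (SchrodingerStability.isAdmissible_powerPotential hp h0)).trans
    (SchrodingerStability.energy_powerPotential_le hp h0)
  rw [add_comm, EReal.coe_add] at hlow
  refine le_trans ?_ (EReal.sub_le_sub hlow hup)
  rw [EReal.add_sub_cancel_right]
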